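/- For a locally finite set $\sigma\subset\mathbb{R}^2$ and $N>0$ let $V_N=[-N,N]^2$, $\sigma_N=\sigma\cap V_N$, let $d(\sigma_N)$ be the minimal distance between distinct points of $\sigma_N$, let $r(\sigma_N)=\frac12 d(\sigma_N)$, and let $$\Delta_N(\sigma)=\frac{\mathrm{vol}\big[\big(\bigcup_{x\in\sigma_N}B(x,r(\sigma_N))\big)\cap V_N\big]}{(2N)^2},\qquad \Delta(\sigma)=\limsup_{N\to\infty}\Delta_N(\sigma),$$ the sphere packing density of $\sigma$. Let $\Lambda_2=SL_2(\mathbb{R})/SL_2(\mathbb{Z})$ be the space of unimodular lattices of $\mathbb{R}^2$, where the coset $g\,SL_2(\mathbb{Z})$ stands for the lattice $g\mathbb{Z}^2$, equipped with the Haar probability measure $\mu$, that is, the $SL_2(\mathbb{R})$-invariant Borel probability measure on $\Lambda_2$. Then under $\mu$ the random variable $\Delta:\Lambda_2\to\mathbb{R}$ has the probability density $$p_\Delta(x)=\begin{cases}\frac{12}{\pi^2} & \text{for } 0\le x\le\frac{\pi}{4},\\[2pt] \frac{12}{\pi^2}\Big(1-2\sqrt{1-\big(\frac{\pi}{4x}\big)^2}\Big)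 & \text{for } \frac{\pi}{4}\le x\le\frac{\pi}{\sqrt{12}},\\[2pt] 0 & \text{for } x<0 \text{ or } x\ge\frac{\pi}{\sqrt{12}}.\end{cases}$$ In particular, the mean of $\Delta$ is $\frac38\log 3$, its variance is $\frac{\pi}{8\sqrt3}-\frac{9}{64}(\log 3)^2$, and the maximal possible sphere packing density, among the unimodular lattices and among all lattices of $\mathbb{R}^2$, is $\frac{\pi}{\sqrt{12}}$ and is attained. -/

import Mathlib

open MeasureTheory Filter Matrix

noncomputable section

/-- The cube in `ℝⁿ` with side `2N` centred at the origin. -/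
def centredCube (n : ℕ) (N : ℝ) : Set (EuclideanSpace ℝ (Fin n)) :=
  {x | ∀ i, |x i| ≤ N}

/-- The sphere packing density of the configuration `σ` in the box with side `2N`: the proportion
of the box that is covered by the equal balls centred at the points of `σ` in the box, with radius
one half of the minimal distance between distinct such points. (`Set.infsep` is the infimum of the
distances between distinct points, which is a minimum for a finite set with at least two points,
and it is `0` for a set with at most one point.) -/
def boxPackingDensity {n : ℕ} (σ : Set (EuclideanSpace ℝ (Fin n))) (N : ℝ) : ℝ :=
  volume.real
    ((⋃ x ∈ σ ∩ centredCube n N, Metric.ball x ((σ ∩ centredCube n N).infsep / 2)) ∩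
      centredCube n N) / (2 * N) ^ n

/-- The sphere packing density of a configuration `σ ⊆ ℝⁿ`. -/
def packingDensity {n : ℕ} (σ : Set (EuclideanSpace ℝ (Fin n))) : ℝ :=
  limsup (fun N : ℝ => boxPackingDensity σ N) atTop

/-- `SL₂(ℤ)` as a subgroup of `SL₂(ℝ)`. -/
abbrev SL2Z : Subgroup (SpecialLinearGroup (Fin 2) ℝ) :=
  (SpecialLinearGroup.map (n := Fin 2) (Int.castRingHom ℝ)).range

/-- The lattice `g ℤ²`, spanned over `ℤ` by the columns of `g`. -/
def columnLattice (g : SpecialLinearGroup (Fin 2) ℝ) : Submodule ℤ (EuclideanSpace ℝ (Fin 2)) :=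
  Submodule.span ℤ (Set.range fun j : Fin 2 => WithLp.toLp 2 (fun i : Fin 2 => g i j))

theorem columnLattice_mul_le (g : SpecialLinearGroup (Fin 2) ℝ) (γ : SpecialLinearGroup (Fin 2) ℤ) :
    columnLattice (g * SpecialLinearGroup.map (Int.castRingHom ℝ) γ) ≤ columnLattice g := by
  refine Submodule.span_le.2 ?_
  rintro _ ⟨j, rfl⟩
  have h : (WithLp.toLp 2 (fun i : Fin 2 =>
        (g * SpecialLinearGroup.map (Int.castRingHom ℝ) γ) i j) : EuclideanSpace ℝ (Fin 2)) =
      ∑ k : Fin 2, γ k j • WithLp.toLp 2 (fun i : Fin 2 => g i k) := by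
    ext i
    simp [Matrix.mul_apply, Fin.sum_univ_two, mul_comm]
  simp only [h]
  exact Submodule.sum_mem _ fun k _ =>
    Submodule.smul_mem _ _ (Submodule.subset_span ⟨k, rfl⟩)

/-- The unimodular lattice `g ℤ²` attached to a point `g SL₂(ℤ)` of `SL₂(ℝ) / SL₂(ℤ)`. -/
def unimodularLattice (q : SpecialLinearGroup (Fin 2) ℝ ⧸ SL2Z) :
    Submodule ℤ (EuclideanSpace ℝ (Fin 2)) :=
  Quotient.liftOn' q columnLattice (by
    intro a b hab
    obtain ⟨γ, hγ⟩ := QuotientGroup.leftRel_apply.1 hab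
    have hb : b = a * SpecialLinearGroup.map (Int.castRingHom ℝ) γ := by rw [hγ]; group
    have ha : a = b * SpecialLinearGroup.map (Int.castRingHom ℝ) γ⁻¹ := by
      rw [hb, map_inv]; group
    refine le_antisymm ?_ ?_
    · conv_lhs => rw [ha]
      exact columnLattice_mul_le b γ⁻¹
    · rw [hb]
      exact columnLattice_mul_le a γ)

/-- The sphere packing density as a function on the space `SL₂(ℝ) / SL₂(ℤ)` of unimodular
lattices in the plane. -/
def latticeDensity (q : SpecialLinearGroup (Fin 2) ℝ ⧸ SL2Z) : ℝ :=
  packingDensity (unimodularLattice q : Set (EuclideanSpace ℝ (Fin 2)))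

/-- The explicit piecewise density on the real line. -/
def densityFun (x : ℝ) : ℝ :=
  if x < 0 then 0
  else if x ≤ Real.pi / 4 then 12 / Real.pi ^ 2
  else if x ≤ Real.pi / √12 then
    12 / Real.pi ^ 2 * (1 - 2 * √(1 - (Real.pi / (4 * x)) ^ 2))
  else 0

end

/-! Write a matrix of determinant one as (v, w) with w = t v + v^⊥/|v|². Left multiplication by k
sends v to kv and adds to t a number that depends only on k and v, so dv dt is a Haar measure on
SL₂(ℝ) (`isMulLeftInvariant_haarSL2`). Counting along cosets turns μ into a sigma-finite
left-invariant measure on the group, which is therefore a multiple of dv dt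
(`exists_unfoldMeasure_eq_smul_haarSL2`).

Every unimodular lattice has a basis with 2|⟨v,w⟩| ≤ |v|² ≤ |w|². Then v is a shortest nonzero
vector, and counting lattice points in large squares gives packing density π|v|²/4
(`packingDensity_eq`, `IsReducedFrame.latticeDensity_eq`). Almost every coset contains exactly two
strictly reduced frames, g and -g (`ae_cosetCount_strictlyReduced`), so the law of Δ is proportional
to the image of dv dt, restricted to these frames, under π|v|²/4.

With n = |v|², strict reducedness reads |t| < 1/2 and t² + 1/n² > 1. This slice has length 1 - 2√(1
- 1/n²), with a root of a negative number read as 0 and a negative length read as 0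
(`volume_strictlyReduced_shifts`). The map π|v|²/4 carries dv to 4 dx on x > 0
(`map_normSq_volume`), and n = 4x/π gives the stated shape. The proportionality constant is never
computed from μ: both sides have mass one (`lintegral_densityFun`). Explicit primitives give the
moments.

The identity |v|²|w|² = 1 + ⟨v,w⟩² forces |v|⁴ ≤ 4/3 for a reduced frame, with equality for the
hexagonal lattice. An arbitrary lattice is a dilate of a unimodular one and has the same density. -/

/-! ### Lifting a measure from a coset space to the group. -/

section Unfolding

variable {G : Type*} [Group G] [MeasurableSpace G] (Γ : Subgroup G)

/-- The counting measure on the coset `q`, as a measure on the group. -/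
noncomputable def cosetCount (q : G ⧸ Γ) : Measure G :=
  Measure.sum fun γ : Γ => Measure.dirac (q.out * (γ : G))

/-- The chosen representative differs from `g` by an element of `Γ`, and translation by that element
only reindexes the sum. -/
theorem cosetCount_mk (g : G) :
    cosetCount Γ (g : G ⧸ Γ) = Measure.sum fun γ : Γ => Measure.dirac (g * (γ : G)) := by
  obtain ⟨h, hh⟩ := QuotientGroup.mk_out_eq_mul Γ g
  unfold cosetCount
  rw [hh]
  ext s hs
  rw [Measure.sum_apply _ hs, Measure.sum_apply _ hs]
  simp only [mul_assoc]
  exact (Equiv.mulLeft h).tsum_eq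
    (fun γ : Γ => Measure.dirac (g * (γ : G)) s)

theorem cosetCount_mk_apply (g : G) {s : Set G} (hs : MeasurableSet s) :
    cosetCount Γ (g : G ⧸ Γ) s = ∑' γ : Γ, s.indicator 1 (g * (γ : G)) := by
  rw [cosetCount_mk, Measure.sum_apply _ hs]
  simp only [Measure.dirac_apply' _ hs]

theorem cosetCount_smul_apply [MeasurableMul G] (k : G) (q : G ⧸ Γ) {s : Set G}
    (hs : MeasurableSet s) :
    cosetCount Γ (k • q) s = cosetCount Γ q ((k * ·) ⁻¹' s) := by
  induction q using QuotientGroup.induction_on with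
  | H g =>
    rw [MulAction.Quotient.smul_coe, cosetCount_mk_apply _ _ hs,
      cosetCount_mk_apply _ _ (measurable_const_mul k hs)]
    simp only [smul_eq_mul, mul_assoc]
    rfl

variable [TopologicalSpace G] [IsTopologicalGroup G] [PolishSpace G] [BorelSpace G]
  [T1Space (G ⧸ Γ)] [MeasurableSpace (G ⧸ Γ)] [BorelSpace (G ⧸ Γ)]

/-- Since `G` is Polish, the Borel σ-algebra of the quotient is the one pushed forward along the
projection. Measurability can thus be checked upstairs. -/
theorem measurable_of_measurable_comp_mk {α : Type*} [MeasurableSpace α] {f : G ⧸ Γ → α}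
    (hf : Measurable fun g : G => f g) : Measurable f := by
  intro s hs
  have h : MeasurableSpace.map (QuotientGroup.mk : G → G ⧸ Γ) ‹MeasurableSpace G› =
      ‹MeasurableSpace (G ⧸ Γ)› := by
    rw [BorelSpace.measurable_eq (α := G ⧸ Γ)]
    exact QuotientGroup.continuous_mk.map_eq_borel QuotientGroup.mk_surjective
  rw [← h]
  exact hf hs

variable [Countable Γ]

theorem measurable_cosetCount : Measurable (cosetCount Γ) := by
  refine Measure.measurable_of_measurable_coe _ fun s hs => ?_
  refine measurable_of_measurable_comp_mk Γ ?_
  simp only [cosetCount_mk_apply Γ _ hs]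
  exact Measurable.tsum fun γ =>
    (measurable_one.indicator hs).comp (measurable_mul_const (γ : G))

/-- The measure on a group obtained from a measure on a coset space by counting along cosets. -/
noncomputable def unfoldMeasure (μ : Measure (G ⧸ Γ)) : Measure G := μ.bind (cosetCount Γ)

theorem unfoldMeasure_apply (μ : Measure (G ⧸ Γ)) {s : Set G} (hs : MeasurableSet s) :
    unfoldMeasure Γ μ s = ∫⁻ q, cosetCount Γ q s ∂μ :=
  Measure.bind_apply hs (measurable_cosetCount Γ).aemeasurable

instance isMulLeftInvariant_unfoldMeasure (μ : Measure (G ⧸ Γ)) [SMulInvariantMeasure G (G ⧸ Γ) μ] :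
    (unfoldMeasure Γ μ).IsMulLeftInvariant where
  map_mul_left_eq_self k := by
    ext s hs
    rw [Measure.map_apply (measurable_const_mul k) hs,
      unfoldMeasure_apply _ _ (measurable_const_mul k hs), unfoldMeasure_apply _ _ hs]
    simp only [← cosetCount_smul_apply Γ k _ hs]
    exact (measurePreserving_smul k μ).lintegral_comp
      ((Measure.measurable_coe hs).comp (measurable_cosetCount Γ))

/-- A coset that meets `A n` in some g meets it only in points gγ with γ in the finite return set.
The number of hits is therefore bounded uniformly in the coset, and μ is finite. -/
theorem sigmaFinite_unfoldMeasure (μ : Measure (G ⧸ Γ)) [IsFiniteMeasure μ] (A : ℕ → Set G)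
    (hA : ∀ n, MeasurableSet (A n)) (hcover : ⋃ n, A n = Set.univ)
    (hfin : ∀ n, {γ : Γ | ∃ g ∈ A n, g * (γ : G) ∈ A n}.Finite) :
    SigmaFinite (unfoldMeasure Γ μ) := by
  refine ⟨⟨⟨A, fun _ => trivial, fun n => ?_, hcover⟩⟩⟩
  have hbound : ∀ q : G ⧸ Γ, cosetCount Γ q (A n) ≤ (hfin n).toFinset.card := by
    intro q
    by_cases hq : ∃ g ∈ A n, (g : G ⧸ Γ) = q
    · obtain ⟨g, hg, rfl⟩ := hq
      rw [cosetCount_mk_apply _ _ (hA n), tsum_eq_sum (s := (hfin n).toFinset)]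
      · refine (Finset.sum_le_card_nsmul _ _ 1 fun γ _ => ?_).trans (by simp)
        exact Set.indicator_le_self' (fun _ _ => zero_le) _
      · intro γ hγ
        refine Set.indicator_of_notMem (fun h => hγ ?_) _
        simpa using ⟨g, hg, h⟩
    · induction q using QuotientGroup.induction_on with
      | H g =>
        rw [cosetCount_mk_apply _ _ (hA n), ENNReal.tsum_eq_zero.2]
        · exact zero_le
        · intro γ
          refine Set.indicator_of_notMem (fun h => hq ⟨_, h, ?_⟩) _
          simp
  rw [unfoldMeasure_apply _ _ (hA n)]
  calc _ ≤ ∫⁻ _, ((hfin n).toFinset.card : ENNReal) ∂μ := lintegral_mono hbound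
    _ < ⊤ := by
      rw [lintegral_const]
      exact ENNReal.mul_lt_top (ENNReal.natCast_lt_top _) (measure_lt_top _ _)

end Unfolding

/-! ### Gram coefficients, topology and compact exhaustion of SL₂(ℝ). -/

section SpecialLinearTwo

instance polishSpace_SL2R : PolishSpace (SpecialLinearGroup (Fin 2) ℝ) :=
  have : PolishSpace (Matrix (Fin 2) (Fin 2) ℝ) :=
    inferInstanceAs (PolishSpace (Fin 2 → Fin 2 → ℝ))
  SpecialLinearGroup.isClosedEmbedding_val.polishSpace

instance countable_SL2Z : Countable SL2Z := by
  have : Countable (Matrix (Fin 2) (Fin 2) ℤ) := inferInstanceAs (Countable (Fin 2 → Fin 2 → ℤ))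
  have : Countable (SpecialLinearGroup (Fin 2) ℤ) := Subtype.countable
  exact (Set.countable_range _).to_subtype

/-- The squared length of the first column. -/
def firstNormSq (g : SpecialLinearGroup (Fin 2) ℝ) : ℝ := g 0 0 ^ 2 + g 1 0 ^ 2

/-- The inner product of the two columns. -/
def columnInner (g : SpecialLinearGroup (Fin 2) ℝ) : ℝ := g 0 0 * g 0 1 + g 1 0 * g 1 1

/-- The squared length of the second column. -/
def secondNormSq (g : SpecialLinearGroup (Fin 2) ℝ) : ℝ := g 0 1 ^ 2 + g 1 1 ^ 2

theorem det_SL2_eq_one (g : SpecialLinearGroup (Fin 2) ℝ) : g 0 0 * g 1 1 - g 0 1 * g 1 0 = 1 := by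
  rw [← Matrix.det_fin_two]; exact g.2

theorem firstNormSq_pos (g : SpecialLinearGroup (Fin 2) ℝ) : 0 < firstNormSq g := by
  have h := det_SL2_eq_one g
  unfold firstNormSq
  by_contra! hc
  have h0 : g 0 0 = 0 := by nlinarith [sq_nonneg (g 0 0), sq_nonneg (g 1 0)]
  have h1 : g 1 0 = 0 := by nlinarith [sq_nonneg (g 0 0), sq_nonneg (g 1 0)]
  simp [h0, h1] at h

theorem firstNormSq_mul_secondNormSq (g : SpecialLinearGroup (Fin 2) ℝ) :
    firstNormSq g * secondNormSq g = 1 + columnInner g ^ 2 := by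
  have h := det_SL2_eq_one g
  unfold firstNormSq secondNormSq columnInner
  linear_combination (g 0 0 * g 1 1 - g 0 1 * g 1 0 + 1) * h

theorem continuous_SL2_entry (i j : Fin 2) :
    Continuous fun g : SpecialLinearGroup (Fin 2) ℝ => g i j :=
  (continuous_apply_apply i j).comp SpecialLinearGroup.isClosedEmbedding_val.continuous

theorem continuous_firstNormSq : Continuous firstNormSq := by
  unfold firstNormSq
  have := continuous_SL2_entry
  fun_prop

theorem continuous_columnInner : Continuous columnInner := by
  unfold columnInner
  have := continuous_SL2_entry
  fun_prop

theorem continuous_secondNormSq : Continuous secondNormSq := by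
  unfold secondNormSq
  have := continuous_SL2_entry
  fun_prop

/-- Matrices of determinant one with entries bounded by `n`. -/
def entryBox (n : ℝ) : Set (SpecialLinearGroup (Fin 2) ℝ) := {g | ∀ i j, |g i j| ≤ n}

theorem isClosed_entryBox (n : ℝ) : IsClosed (entryBox n) := by
  have := continuous_SL2_entry
  simp only [entryBox, Set.ofPred_forall]
  exact isClosed_iInter fun i => isClosed_iInter fun j =>
    isClosed_le (this i j).abs continuous_const

/-- If g and h = gγ lie in the box, then γ = g⁻¹h. Inverting a 2×2 matrix of determinant one only
permutes its entries up to sign, so γ is an integer matrix with entries at most 2n². -/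
theorem finite_return_entryBox (n : ℝ) :
    {γ : SL2Z | ∃ g ∈ entryBox n, g * (γ : SpecialLinearGroup (Fin 2) ℝ) ∈ entryBox n}.Finite := by
  have hfin : {M : Fin 2 → Fin 2 → ℤ | ∀ i j, |M i j| ≤ ⌈2 * n ^ 2⌉}.Finite := by
    refine (Set.finite_Icc (fun _ _ => -⌈2 * n ^ 2⌉) (fun _ _ => ⌈2 * n ^ 2⌉)).subset ?_
    intro M hM
    exact ⟨fun i j => (abs_le.1 (hM i j)).1, fun i j => (abs_le.1 (hM i j)).2⟩
  have hinj : Function.Injective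
      (fun γ : SL2Z => (fun i j => (γ : SpecialLinearGroup (Fin 2) ℝ) i j : Fin 2 → Fin 2 → ℝ)) := by
    intro γ δ h
    refine Subtype.ext (Subtype.ext ?_)
    exact h
  refine Set.Finite.of_finite_image
    ((hfin.image fun M => (fun i j => (M i j : ℝ) : Fin 2 → Fin 2 → ℝ)).subset ?_)
    hinj.injOn
  rintro _ ⟨⟨_, M, rfl⟩, ⟨g, hg, hgM⟩, rfl⟩
  refine ⟨fun i j => M i j, fun i j => ?_, rfl⟩
  have hbound : ∀ i j : Fin 2, |(M i j : ℝ)| ≤ 2 * n ^ 2 := by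
    set h := g * SpecialLinearGroup.map (Int.castRingHom ℝ) M with hh
    have hM : SpecialLinearGroup.map (Int.castRingHom ℝ) M = g⁻¹ * h := by rw [hh]; group
    have hn : 0 ≤ n := (abs_nonneg _).trans (hg 0 0)
    have hinv : ∀ i j, |(g⁻¹ : SpecialLinearGroup (Fin 2) ℝ) i j| ≤ n := by
      intro i j
      have := hg 0 0; have := hg 0 1; have := hg 1 0; have := hg 1 1
      fin_cases i <;> fin_cases j <;>
        simpa [SpecialLinearGroup.coe_inv, Matrix.adjugate_fin_two] using by assumption
    intro i j
    have he : (M i j : ℝ) = (g⁻¹ : SpecialLinearGroup (Fin 2) ℝ) i 0 * h 0 j +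
        (g⁻¹ : SpecialLinearGroup (Fin 2) ℝ) i 1 * h 1 j := by
      have := congrArg (fun A : SpecialLinearGroup (Fin 2) ℝ => A i j) hM
      simpa [Matrix.mul_apply, Fin.sum_univ_two] using this
    rw [he]
    refine (abs_add_le _ _).trans ?_
    rw [abs_mul, abs_mul]
    have h1 := mul_le_mul (hinv i 0) (hgM 0 j) (abs_nonneg _) hn
    have h2 := mul_le_mul (hinv i 1) (hgM 1 j) (abs_nonneg _) hn
    nlinarith
  have := (hbound i j).trans (Int.le_ceil _)
  exact_mod_cast this

variable [MeasurableSpace (SpecialLinearGroup (Fin 2) ℝ)] [BorelSpace (SpecialLinearGroup (Fin 2) ℝ)]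

theorem measurable_SL2_of_entries {α : Type*} [MeasurableSpace α]
    {f : α → SpecialLinearGroup (Fin 2) ℝ} (hf : ∀ i j, Measurable fun x => f x i j) :
    Measurable f := by
  have he : Topology.IsClosedEmbedding
      (fun g : SpecialLinearGroup (Fin 2) ℝ => (fun i j => g i j : Fin 2 → Fin 2 → ℝ)) :=
    SpecialLinearGroup.isClosedEmbedding_val (n := Fin 2) (R := ℝ)
  rw [← he.measurableEmbedding.measurable_comp_iff]
  exact measurable_pi_lambda _ fun i => measurable_pi_lambda _ fun j => hf i j

instance sigmaFinite_unfoldMeasure_SL2Z [MeasurableSpace (SpecialLinearGroup (Fin 2) ℝ ⧸ SL2Z)]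
    [BorelSpace (SpecialLinearGroup (Fin 2) ℝ ⧸ SL2Z)]
    (μ : Measure (SpecialLinearGroup (Fin 2) ℝ ⧸ SL2Z)) [IsFiniteMeasure μ] :
    SigmaFinite (unfoldMeasure SL2Z μ) := by
  refine sigmaFinite_unfoldMeasure SL2Z μ (fun n => entryBox n)
    (fun n => (isClosed_entryBox _).measurableSet) ?_ fun n => finite_return_entryBox n
  refine Set.eq_univ_of_forall fun g => Set.mem_iUnion.2 ?_
  obtain ⟨n, hn⟩ := exists_nat_ge (∑ i, ∑ j, |g i j|)
  refine ⟨n, fun i j => le_trans ?_ hn⟩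
  refine le_trans ?_ (Finset.single_le_sum (f := fun i => ∑ j, |g i j|)
    (fun _ _ => Finset.sum_nonneg fun _ _ => abs_nonneg _) (Finset.mem_univ i))
  exact Finset.single_le_sum (f := fun j => |g i j|) (fun _ _ => abs_nonneg _) (Finset.mem_univ j)

end SpecialLinearTwo

/-! ### Haar measure on SL₂(ℝ) in the coordinates (v, t). -/

section HaarSL2

/-- The matrix of determinant one with first column `p.1`, whose second column has inner product
`p.2 * |p.1|²` with the first one (and the identity if `p.1 = 0`). -/
noncomputable def frame (p : (Fin 2 → ℝ) × ℝ) : SpecialLinearGroup (Fin 2) ℝ :=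
  if h : p.1 0 ^ 2 + p.1 1 ^ 2 = 0 then 1 else
    ⟨!![p.1 0, p.2 * p.1 0 - p.1 1 / (p.1 0 ^ 2 + p.1 1 ^ 2);
        p.1 1, p.2 * p.1 1 + p.1 0 / (p.1 0 ^ 2 + p.1 1 ^ 2)], by
      rw [Matrix.det_fin_two_of]; field_simp; ring⟩

/-- The inverse of `frame`. -/
noncomputable def frameCoord (g : SpecialLinearGroup (Fin 2) ℝ) : (Fin 2 → ℝ) × ℝ :=
  (fun i => g i 0, columnInner g / firstNormSq g)

theorem normSq_ne_zero {v : Fin 2 → ℝ} (hv : v ≠ 0) : v 0 ^ 2 + v 1 ^ 2 ≠ 0 := by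
  intro h
  refine hv (funext fun i => ?_)
  fin_cases i <;> simp <;> nlinarith [sq_nonneg (v 0), sq_nonneg (v 1)]

theorem frame_entries {v : Fin 2 → ℝ} (hv : v ≠ 0) (t : ℝ) :
    frame (v, t) 0 0 = v 0 ∧ frame (v, t) 1 0 = v 1 ∧
    frame (v, t) 0 1 = t * v 0 - v 1 / (v 0 ^ 2 + v 1 ^ 2) ∧
    frame (v, t) 1 1 = t * v 1 + v 0 / (v 0 ^ 2 + v 1 ^ 2) := by
  simp [frame, normSq_ne_zero hv]

theorem firstNormSq_frame {v : Fin 2 → ℝ} (hv : v ≠ 0) (t : ℝ) :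
    firstNormSq (frame (v, t)) = v 0 ^ 2 + v 1 ^ 2 := by
  obtain ⟨h1, h2, -, -⟩ := frame_entries hv t
  rw [firstNormSq, h1, h2]

theorem columnInner_frame {v : Fin 2 → ℝ} (hv : v ≠ 0) (t : ℝ) :
    columnInner (frame (v, t)) = t * (v 0 ^ 2 + v 1 ^ 2) := by
  obtain ⟨h1, h2, h3, h4⟩ := frame_entries hv t
  have := normSq_ne_zero hv
  rw [columnInner, h1, h2, h3, h4]
  ring

theorem secondNormSq_frame {v : Fin 2 → ℝ} (hv : v ≠ 0) (t : ℝ) :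
    secondNormSq (frame (v, t)) = t ^ 2 * (v 0 ^ 2 + v 1 ^ 2) + 1 / (v 0 ^ 2 + v 1 ^ 2) := by
  have h := firstNormSq_mul_secondNormSq (frame (v, t))
  rw [firstNormSq_frame hv, columnInner_frame hv] at h
  have := normSq_ne_zero hv
  field_simp
  linear_combination h

theorem frameCoord_frame {v : Fin 2 → ℝ} (hv : v ≠ 0) (t : ℝ) : frameCoord (frame (v, t)) = (v, t) := by
  obtain ⟨h1, h2, -, -⟩ := frame_entries hv t
  refine Prod.ext (funext fun i => ?_) ?_
  · fin_cases i
    exacts [h1, h2]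
  · have := normSq_ne_zero hv
    simp only [frameCoord, firstNormSq_frame hv, columnInner_frame hv]
    field_simp

theorem frameCoord_fst_ne_zero (g : SpecialLinearGroup (Fin 2) ℝ) : (frameCoord g).1 ≠ 0 := by
  intro h
  have h0 : g 0 0 = 0 := congrFun h 0
  have h1 : g 1 0 = 0 := congrFun h 1
  have := firstNormSq_pos g
  simp [firstNormSq, h0, h1] at this

theorem frame_frameCoord (g : SpecialLinearGroup (Fin 2) ℝ) : frame (frameCoord g) = g := by
  obtain ⟨h1, h2, h3, h4⟩ := frame_entries (frameCoord_fst_ne_zero g) (frameCoord g).2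
  have hdet := det_SL2_eq_one g
  have hpos : g 0 0 ^ 2 + g 1 0 ^ 2 ≠ 0 := (firstNormSq_pos g).ne'
  ext i j
  fin_cases i <;> fin_cases j
  · exact h1
  · refine h3.trans ?_
    simp only [frameCoord, columnInner, firstNormSq, Fin.zero_eta, Fin.mk_one]
    field_simp
    linear_combination (g 1 0) * hdet
  · exact h2
  · refine h4.trans ?_
    simp only [frameCoord, columnInner, firstNormSq, Fin.mk_one]
    field_simp
    linear_combination (-g 0 0) * hdet

theorem SL2_mul_entry (g h : SpecialLinearGroup (Fin 2) ℝ) (i j : Fin 2) :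
    (g * h) i j = g i 0 * h 0 j + g i 1 * h 1 j :=
  (Matrix.mul_apply (M := g.1) (N := h.1)).trans (Fin.sum_univ_two _)

/-- The frame at (v, t) is the frame at (v, 0) times an upper unipotent matrix with entry t, and
right multiplication commutes with k. Hence k acts on t by a translation that does not involve t,
which is what makes dv dt invariant. -/
theorem mul_frame (k : SpecialLinearGroup (Fin 2) ℝ) {v : Fin 2 → ℝ} (hv : v ≠ 0) (t : ℝ) :
    k * frame (v, t) = frame (k.1 *ᵥ v, t + (frameCoord (k * frame (v, 0))).2) := by
  rw [← frame_frameCoord (k * frame (v, t))]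
  congr 1
  obtain ⟨h1, h2, h3, h4⟩ := frame_entries hv t
  obtain ⟨z1, z2, z3, z4⟩ := frame_entries hv 0
  refine Prod.ext (funext fun i => ?_) ?_
  · simp only [frameCoord, SL2_mul_entry, h1, h2, Matrix.mulVec, dotProduct, Fin.sum_univ_two]
  · have hn := (firstNormSq_pos (k * frame (v, 0))).ne'
    simp only [frameCoord, firstNormSq, columnInner, SL2_mul_entry, h1, h2, h3, h4, z1, z2, z3,
      z4] at hn ⊢
    rw [div_eq_iff hn, add_mul t, div_mul_cancel₀ _ hn]
    ring

theorem lintegral_mulVec_SL2 (k : SpecialLinearGroup (Fin 2) ℝ) {f : (Fin 2 → ℝ) → ENNReal}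
    (hf : Measurable f) : ∫⁻ v, f (k.1 *ᵥ v) = ∫⁻ v, f v := by
  have h := Real.map_matrix_volume_pi_eq_smul_volume_pi (M := k.1) (by simp)
  conv_rhs => rw [show (volume : Measure (Fin 2 → ℝ)) = Measure.map (toLin' k.1) volume by
    rw [h]; simp]
  rw [lintegral_map hf]
  · rfl
  · exact (LinearMap.continuous_on_pi _).measurable

variable [MeasurableSpace (SpecialLinearGroup (Fin 2) ℝ)] [BorelSpace (SpecialLinearGroup (Fin 2) ℝ)]

theorem measurable_frame : Measurable frame := by
  refine measurable_SL2_of_entries fun i j => ?_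
  have h : (fun p => frame p i j) = fun p : (Fin 2 → ℝ) × ℝ =>
      if p.1 = 0 then (1 : Matrix (Fin 2) (Fin 2) ℝ) i j else
        ![![p.1 0, p.2 * p.1 0 - p.1 1 / (p.1 0 ^ 2 + p.1 1 ^ 2)],
          ![p.1 1, p.2 * p.1 1 + p.1 0 / (p.1 0 ^ 2 + p.1 1 ^ 2)]] i j := by
    ext ⟨v, t⟩
    by_cases hv : v = 0
    · simp [frame, hv]
    · obtain ⟨h1, h2, h3, h4⟩ := frame_entries hv t
      rw [if_neg hv]
      fin_cases i <;> fin_cases j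
      exacts [h1, h3, h2, h4]
  rw [h]
  refine Measurable.ite (measurable_fst (measurableSet_singleton 0)) measurable_const ?_
  fin_cases i <;> fin_cases j <;> simp <;> fun_prop

theorem measurable_frameCoord : Measurable frameCoord := by
  refine Measurable.prodMk (measurable_pi_lambda _ fun i => (continuous_SL2_entry i 0).measurable) ?_
  exact continuous_columnInner.measurable.div continuous_firstNormSq.measurable

/-- An explicit Haar measure on `SL₂(ℝ)`. -/
noncomputable def haarSL2 : Measure (SpecialLinearGroup (Fin 2) ℝ) :=
  (volume : Measure ((Fin 2 → ℝ) × ℝ)).map frame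

theorem lintegral_haarSL2 {f : SpecialLinearGroup (Fin 2) ℝ → ENNReal} (hf : Measurable f) :
    ∫⁻ g, f g ∂haarSL2 = ∫⁻ v : Fin 2 → ℝ, ∫⁻ t : ℝ, f (frame (v, t)) := by
  rw [haarSL2, lintegral_map hf measurable_frame, Measure.volume_eq_prod,
    lintegral_prod (fun p => f (frame p)) (hf.comp measurable_frame).aemeasurable]

instance isMulLeftInvariant_haarSL2 : haarSL2.IsMulLeftInvariant where
  map_mul_left_eq_self k := by
    refine Measure.ext_of_lintegral _ fun f hf => ?_
    rw [lintegral_map hf (measurable_const_mul k), lintegral_haarSL2 hf,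
      lintegral_haarSL2 (f := fun g => f (k * g)) (hf.comp (measurable_const_mul k)),
      ← lintegral_mulVec_SL2 k (f := fun v => ∫⁻ t, f (frame (v, t)))]
    · refine lintegral_congr_ae ?_
      filter_upwards [Measure.ae_ne volume (0 : Fin 2 → ℝ)] with v hv
      refine (lintegral_congr fun t => by rw [mul_frame k hv t]).trans ?_
      exact lintegral_add_right_eq_self (fun t => f (frame (k.1 *ᵥ v, t))) _
    · exact (hf.comp measurable_frame).lintegral_prod_right'

theorem haarSL2_preimage_frameCoord {s : Set ((Fin 2 → ℝ) × ℝ)} (hs : MeasurableSet s) :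
    haarSL2 (frameCoord ⁻¹' s) = volume s := by
  rw [haarSL2, Measure.map_apply measurable_frame (measurable_frameCoord hs)]
  refine measure_congr ?_
  -- `frame` takes its default value 1 where the vector is zero; only on this null set does
  -- `frameCoord` fail to invert it.
  have h : ∀ᵐ p : (Fin 2 → ℝ) × ℝ, p.1 ≠ 0 := by
    rw [Measure.volume_eq_prod]
    exact Measure.quasiMeasurePreserving_fst.ae (Measure.ae_ne volume (0 : Fin 2 → ℝ))
  filter_upwards [h] with p hp
  refine propext ?_
  change frameCoord (frame p) ∈ s ↔ p ∈ s
  rw [frameCoord_frame hp p.2]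

instance sigmaFinite_haarSL2 : SigmaFinite haarSL2 := by
  refine ⟨⟨⟨fun n => frameCoord ⁻¹' spanningSets volume n, fun _ => trivial, fun n => ?_, ?_⟩⟩⟩
  · rw [haarSL2_preimage_frameCoord (measurableSet_spanningSets _ _)]
    exact measure_spanningSets_lt_top _ _
  · rw [← Set.preimage_iUnion, iUnion_spanningSets, Set.preimage_univ]

theorem exists_unfoldMeasure_eq_smul_haarSL2
    [MeasurableSpace (SpecialLinearGroup (Fin 2) ℝ ⧸ SL2Z)]
    [BorelSpace (SpecialLinearGroup (Fin 2) ℝ ⧸ SL2Z)]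
    (μ : Measure (SpecialLinearGroup (Fin 2) ℝ ⧸ SL2Z)) [IsFiniteMeasure μ]
    [SMulInvariantMeasure (SpecialLinearGroup (Fin 2) ℝ)
      (SpecialLinearGroup (Fin 2) ℝ ⧸ SL2Z) μ] :
    ∃ c : ENNReal, unfoldMeasure SL2Z μ = c • haarSL2 := by
  -- Uniqueness of invariant measures needs a test set of finite nonzero measure; the coordinate
  -- unit cube has measure 1.
  have hs : MeasurableSet (Set.Icc (0 : Fin 2 → ℝ) 1 ×ˢ Set.Icc (0 : ℝ) 1) :=
    measurableSet_Icc.prod measurableSet_Icc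
  have h1 : haarSL2 (frameCoord ⁻¹' (Set.Icc (0 : Fin 2 → ℝ) 1 ×ˢ Set.Icc (0 : ℝ) 1)) = 1 := by
    rw [haarSL2_preimage_frameCoord hs, Measure.volume_eq_prod, Measure.prod_prod, Real.volume_Icc_pi]
    simp
  exact ⟨_, measure_eq_div_smul _ haarSL2 (by rw [h1]; simp) (by rw [h1]; simp)⟩

end HaarSL2

/-! ### Lagrange-Gauss reduction of planar bases. -/

section Reduction

theorem one_le_sq_sub_abs_mul_add_sq {p r : ℤ} (h : p ≠ 0 ∨ r ≠ 0) :
    1 ≤ p ^ 2 - |p| * |r| + r ^ 2 := by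
  rw [← sq_abs p, ← sq_abs r]
  by_contra! hc
  have h4 : (2 * |p| - |r|) ^ 2 + 3 * |r| ^ 2 ≤ 0 := by nlinarith
  have hr : |r| = 0 := by nlinarith [sq_nonneg (2 * |p| - |r|), sq_nonneg |r|]
  have hp : |p| = 0 := by
    rw [hr] at h4
    nlinarith [sq_nonneg |p|]
  simp_all

/-- A reduced positive definite binary quadratic form has minimum `a` on nonzero integer vectors. -/
theorem le_quadraticForm_of_reduced {a b d : ℝ} (hb : 2 * |b| ≤ a) (hd : a ≤ d) {p r : ℤ}
    (h : p ≠ 0 ∨ r ≠ 0) : a ≤ p ^ 2 * a + 2 * (p * r) * b + r ^ 2 * d := by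
  -- As 2|b| ≤ a ≤ d, the form is at least a(p² - |p||r| + r²), and the second factor is a positive
  -- integer.
  have h1 : (1 : ℝ) ≤ (p : ℝ) ^ 2 - |(p : ℝ)| * |(r : ℝ)| + (r : ℝ) ^ 2 := by
    exact_mod_cast one_le_sq_sub_abs_mul_add_sq h
  have ha : 0 ≤ a := (by positivity : 0 ≤ 2 * |b|).trans hb
  have h2 : -(|(p : ℝ)| * |(r : ℝ)| * (2 * |b|)) ≤ 2 * (p * r) * b := by
    have := neg_abs_le ((p : ℝ) * r * b)
    rw [abs_mul, abs_mul] at this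
    linarith
  have h3 : |(p : ℝ)| * |(r : ℝ)| * (2 * |b|) ≤ |(p : ℝ)| * |(r : ℝ)| * a := by gcongr
  have h4 : (r : ℝ) ^ 2 * a ≤ (r : ℝ) ^ 2 * d := by gcongr
  nlinarith

theorem lt_quadraticForm_of_strictlyReduced {a b d : ℝ} (hb : 2 * |b| < a) (hd : a < d) {p r : ℤ}
    (h : r ≠ 0) : a < p ^ 2 * a + 2 * (p * r) * b + r ^ 2 * d := by
  have h1 := le_quadraticForm_of_reduced hb.le le_rfl (p := p) (Or.inr h)
  have h4 : (r : ℝ) ^ 2 * a < (r : ℝ) ^ 2 * d := by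
    have : (0 : ℝ) < (r : ℝ) ^ 2 := by positivity
    gcongr
  linarith

/-- The columns of `g` form a Lagrange-Gauss reduced basis. -/
def IsReducedFrame (g : SpecialLinearGroup (Fin 2) ℝ) : Prop :=
  2 * |columnInner g| ≤ firstNormSq g ∧ firstNormSq g ≤ secondNormSq g

/-- The columns of `g` form a reduced basis for which all the inequalities are strict. -/
def IsStrictlyReducedFrame (g : SpecialLinearGroup (Fin 2) ℝ) : Prop :=
  2 * |columnInner g| < firstNormSq g ∧ firstNormSq g < secondNormSq g

theorem IsStrictlyReducedFrame.isReducedFrame {g : SpecialLinearGroup (Fin 2) ℝ}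
    (h : IsStrictlyReducedFrame g) : IsReducedFrame g :=
  ⟨h.1.le, h.2.le⟩

theorem mul_map_entry (g : SpecialLinearGroup (Fin 2) ℝ) (γ : SpecialLinearGroup (Fin 2) ℤ)
    (i j : Fin 2) :
    (g * SpecialLinearGroup.map (Int.castRingHom ℝ) γ) i j = g i 0 * γ 0 j + g i 1 * γ 1 j :=
  SL2_mul_entry _ _ i j

theorem firstNormSq_mul_map (g : SpecialLinearGroup (Fin 2) ℝ) (γ : SpecialLinearGroup (Fin 2) ℤ) :
    firstNormSq (g * SpecialLinearGroup.map (Int.castRingHom ℝ) γ) =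
      (γ 0 0 : ℝ) ^ 2 * firstNormSq g + 2 * (γ 0 0 * γ 1 0) * columnInner g +
        (γ 1 0 : ℝ) ^ 2 * secondNormSq g := by
  simp only [firstNormSq, columnInner, secondNormSq, mul_map_entry]
  ring

theorem columnInner_mul_map (g : SpecialLinearGroup (Fin 2) ℝ) (γ : SpecialLinearGroup (Fin 2) ℤ) :
    columnInner (g * SpecialLinearGroup.map (Int.castRingHom ℝ) γ) =
      (γ 0 0 * γ 0 1 : ℝ) * firstNormSq g + (γ 0 0 * γ 1 1 + γ 0 1 * γ 1 0) * columnInner g +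
        (γ 1 0 * γ 1 1 : ℝ) * secondNormSq g := by
  simp only [firstNormSq, columnInner, secondNormSq, mul_map_entry]
  ring

theorem det_SL2Z_eq_one (γ : SpecialLinearGroup (Fin 2) ℤ) : γ 0 0 * γ 1 1 - γ 0 1 * γ 1 0 = 1 := by
  rw [← Matrix.det_fin_two]; exact γ.2

theorem SL2Z_col_ne_zero (γ : SpecialLinearGroup (Fin 2) ℤ) : γ 0 0 ≠ 0 ∨ γ 1 0 ≠ 0 := by
  by_contra! h
  have := det_SL2Z_eq_one γ
  simp [h.1, h.2] at this

theorem IsReducedFrame.firstNormSq_le {g : SpecialLinearGroup (Fin 2) ℝ} (h : IsReducedFrame g)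
    (γ : SpecialLinearGroup (Fin 2) ℤ) :
    firstNormSq g ≤ firstNormSq (g * SpecialLinearGroup.map (Int.castRingHom ℝ) γ) := by
  rw [firstNormSq_mul_map]
  exact le_quadraticForm_of_reduced h.1 h.2 (SL2Z_col_ne_zero γ)

/-- With Gram coefficients a, b, d one has a² ≤ ad = 1 + b² ≤ 1 + a²/4. -/
theorem IsReducedFrame.firstNormSq_sq_le {g : SpecialLinearGroup (Fin 2) ℝ}
    (h : IsReducedFrame g) : firstNormSq g ^ 2 ≤ 4 / 3 := by
  have h1 := firstNormSq_mul_secondNormSq g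
  have h2 : (2 * |columnInner g|) ^ 2 ≤ firstNormSq g ^ 2 := by
    have := h.1
    gcongr
  rw [mul_pow, sq_abs] at h2
  nlinarith [mul_le_mul_of_nonneg_left h.2 (firstNormSq_pos g).le]

/-- Both first columns are shortest vectors of the same lattice, so they have equal length, and
strictness forces the lower left entry of γ to vanish. Then γ is triangular with equal diagonal
entries ±1 and changes the inner product b by an integer multiple of a. As |b| < a/2 before and
after, that integer is 0. -/
theorem eq_one_or_neg_one_of_isStrictlyReducedFrame {g : SpecialLinearGroup (Fin 2) ℝ}
    {γ : SpecialLinearGroup (Fin 2) ℤ} (hg : IsStrictlyReducedFrame g)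
    (hγ : IsStrictlyReducedFrame (g * SpecialLinearGroup.map (Int.castRingHom ℝ) γ)) :
    γ = 1 ∨ γ = -1 := by
  have hle : firstNormSq (g * SpecialLinearGroup.map (Int.castRingHom ℝ) γ) ≤ firstNormSq g := by
    have := hγ.isReducedFrame.firstNormSq_le γ⁻¹
    rwa [mul_assoc, ← map_mul, mul_inv_cancel, map_one, mul_one] at this
  have hr : γ 1 0 = 0 := by
    by_contra hr
    rw [firstNormSq_mul_map] at hle
    exact (lt_quadraticForm_of_strictlyReduced hg.1 hg.2 hr).not_ge hle
  have hdet := det_SL2Z_eq_one γ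
  rw [hr, mul_zero, sub_zero] at hdet
  have ha : firstNormSq (g * SpecialLinearGroup.map (Int.castRingHom ℝ) γ) = firstNormSq g :=
    le_antisymm hle (hg.isReducedFrame.firstNormSq_le γ)
  have hb := hγ.1
  have hg1 := hg.1
  have hpos := firstNormSq_pos g
  rw [ha, columnInner_mul_map, hr] at hb
  have hps : (γ 0 0 : ℝ) * γ 1 1 = 1 := by exact_mod_cast hdet
  simp only [Int.cast_zero, mul_zero, zero_mul, add_zero, hps, one_mul] at hb
  have hq : γ 0 0 * γ 0 1 = 0 := by
    rw [← Int.abs_lt_one_iff]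
    have h1 : |((γ 0 0 * γ 0 1 : ℤ) : ℝ)| * firstNormSq g < 1 * firstNormSq g := by
      push_cast
      rw [← abs_of_pos hpos, ← abs_mul, abs_of_pos hpos]
      have := abs_sub_abs_le_abs_sub ((γ 0 0 : ℝ) * γ 0 1 * firstNormSq g) (-columnInner g)
      rw [abs_neg, sub_neg_eq_add] at this
      linarith
    have := lt_of_mul_lt_mul_right h1 hpos.le
    exact_mod_cast this
  have hq0 : γ 0 1 = 0 := by
    rcases mul_eq_zero.1 hq with h | h
    · simp [h] at hdet
    · exact h
  rcases Int.mul_eq_one_iff_eq_one_or_neg_one.1 hdet with h | h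
  · left
    ext i j
    fin_cases i <;> fin_cases j <;> simp [hr, hq0, h.1, h.2]
  · right
    ext i j
    fin_cases i <;> fin_cases j <;> simp [hr, hq0, h.1, h.2]

/-- Read the columns as complex numbers: their quotient z = w/v equals (b + i)/a and lies in the
upper half plane. Moving z into the standard fundamental domain gives |Re z| ≤ 1/2, that is 2|b| ≤
a, and |z| ≥ 1, that is a² ≤ 1 + b² = ad. -/
theorem exists_isReducedFrame_mul (g : SpecialLinearGroup (Fin 2) ℝ) :
    ∃ γ : SpecialLinearGroup (Fin 2) ℤ,
      IsReducedFrame (g * SpecialLinearGroup.map (Int.castRingHom ℝ) γ) := by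
  have hquot : ∀ h : SpecialLinearGroup (Fin 2) ℝ,
      ((h 0 1 : ℂ) + h 1 1 * Complex.I) / (h 0 0 + h 1 0 * Complex.I) =
        ⟨columnInner h / firstNormSq h, 1 / firstNormSq h⟩ := by
    intro h
    have ha := firstNormSq_pos h
    have hdet := det_SL2_eq_one h
    have hne : (h 0 0 : ℂ) + h 1 0 * Complex.I ≠ 0 := by
      intro h0
      have h1 := congrArg Complex.re h0
      have h2 := congrArg Complex.im h0
      simp at h1 h2
      simp [firstNormSq, h1, h2] at ha
    rw [div_eq_iff hne]
    apply Complex.ext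
    · simp
      field_simp
      simp only [firstNormSq, columnInner]
      linear_combination (-h 1 0) * hdet
    · simp
      field_simp
      simp only [firstNormSq, columnInner]
      linear_combination (h 0 0) * hdet
  have hpos := firstNormSq_pos g
  let z : UpperHalfPlane := ⟨⟨columnInner g / firstNormSq g, 1 / firstNormSq g⟩, by
    change 0 < 1 / firstNormSq g
    positivity⟩
  obtain ⟨M, hM⟩ := ModularGroup.exists_smul_mem_fd z
  -- The entries of `M` are rearranged so that the new columns are M₁₁v + M₁₀w and M₀₁v + M₀₀w,
  -- whose quotient is the Möbius image of w/v under `M`.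
  let γ : SpecialLinearGroup (Fin 2) ℤ := ⟨!![M 1 1, M 0 1; M 1 0, M 0 0], by
    rw [Matrix.det_fin_two_of]
    linarith [det_SL2Z_eq_one M]⟩
  refine ⟨γ, ?_⟩
  set h := g * SpecialLinearGroup.map (Int.castRingHom ℝ) γ with hh
  have hz : ((M • z : UpperHalfPlane) : ℂ) = ⟨columnInner h / firstNormSq h, 1 / firstNormSq h⟩ := by
    rw [← hquot h, UpperHalfPlane.specialLinearGroup_apply]
    have hzg : (z : ℂ) = ((g 0 1 : ℂ) + g 1 1 * Complex.I) / (g 0 0 + g 1 0 * Complex.I) :=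
      (hquot g).symm
    have hne : (g 0 0 : ℂ) + g 1 0 * Complex.I ≠ 0 := by
      intro h0
      have h1 := congrArg Complex.re h0
      have h2 := congrArg Complex.im h0
      simp at h1 h2
      simp [firstNormSq, h1, h2] at hpos
    have e1 : h 0 0 = g 0 0 * M 1 1 + g 0 1 * M 1 0 := mul_map_entry g γ 0 0
    have e2 : h 1 0 = g 1 0 * M 1 1 + g 1 1 * M 1 0 := mul_map_entry g γ 1 0
    have e3 : h 0 1 = g 0 0 * M 0 1 + g 0 1 * M 0 0 := mul_map_entry g γ 0 1
    have e4 : h 1 1 = g 1 0 * M 0 1 + g 1 1 * M 0 0 := mul_map_entry g γ 1 1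
    simp only [hzg, e1, e2, e3, e4]
    rw [← mul_div_mul_right _ _ hne]
    simp only [add_mul, mul_div_assoc', div_mul_cancel₀ _ hne]
    push_cast
    congr 1 <;> simp <;> ring
  have hapos := firstNormSq_pos h
  have hprod := firstNormSq_mul_secondNormSq h
  obtain ⟨h1, h2⟩ := hM
  rw [hz, Complex.normSq_mk] at h1
  have h2' : |columnInner h / firstNormSq h| ≤ 1 / 2 := by
    have : (M • z : UpperHalfPlane).re = columnInner h / firstNormSq h := congrArg Complex.re hz
    rwa [this] at h2
  rw [abs_div, abs_of_pos hapos, div_le_iff₀ hapos] at h2'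
  refine ⟨by linarith, ?_⟩
  field_simp at h1
  nlinarith

end Reduction

/-! ### Packing density of a planar lattice from its shortest vector. -/

section PackingDensity

theorem centredCube_eq_preimage (n : ℕ) (N : ℝ) :
    centredCube n N = WithLp.ofLp ⁻¹' Set.Icc (fun _ => -N) (fun _ => N) := by
  ext x
  simp only [centredCube, Set.mem_ofPred_eq, abs_le, Set.mem_preimage, Set.mem_Icc, Pi.le_def,
    forall_and]

theorem measurableSet_centredCube (n : ℕ) (N : ℝ) : MeasurableSet (centredCube n N) := by
  rw [centredCube_eq_preimage]
  exact (PiLp.volume_preserving_ofLp (Fin n)).measurable measurableSet_Icc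

theorem volume_centredCube (n : ℕ) (N : ℝ) :
    volume (centredCube n N) = ENNReal.ofReal (2 * N) ^ n := by
  rw [centredCube_eq_preimage, (PiLp.volume_preserving_ofLp (Fin n)).measure_preimage
    measurableSet_Icc.nullMeasurableSet, Real.volume_Icc_pi]
  simp [two_mul]

theorem isBounded_centredCube (n : ℕ) (N : ℝ) : Bornology.IsBounded (centredCube n N) := by
  rw [centredCube_eq_preimage]
  exact (PiLp.antilipschitzWith_ofLp 2 fun _ : Fin n => ℝ).isBounded_preimage
    (Metric.isBounded_Icc _ _)

theorem convex_centredCube (n : ℕ) (N : ℝ) : Convex ℝ (centredCube n N) := by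
  rw [centredCube_eq_preimage]
  exact (convex_Icc _ _).linear_preimage (WithLp.linearEquiv 2 ℝ (Fin n → ℝ)).toLinearMap

variable (L : Submodule ℤ (EuclideanSpace ℝ (Fin 2))) [DiscreteTopology L]

theorem finite_inter_centredCube (N : ℝ) :
    ((L : Set (EuclideanSpace ℝ (Fin 2))) ∩ centredCube 2 N).Finite := by
  rw [Set.inter_comm]
  have : DiscreteTopology L.toAddSubgroup := ‹DiscreteTopology L›
  exact Metric.finite_isBounded_inter_isClosed (s := (L : Set (EuclideanSpace ℝ (Fin 2))))
    (isDiscrete_iff_discreteTopology.2 ‹_›) (isBounded_centredCube 2 N) (AddSubgroup.isClosed_of_discrete (H := L.toAddSubgroup))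

/-- The general point count for a gauge homogeneous of degree 2, applied to the squared sup norm.
The unit square has area 4, and its boundary is null by convexity. -/
theorem tendsto_card_inter_centredCube [IsZLattice ℝ L] :
    Tendsto (fun N : ℝ => (((L : Set (EuclideanSpace ℝ (Fin 2))) ∩ centredCube 2 N).ncard : ℝ) /
      N ^ 2) atTop (nhds (4 / ZLattice.covolume L)) := by
  have hset : ∀ c : ℝ, {x ∈ (Set.univ : Set (EuclideanSpace ℝ (Fin 2))) |
      ‖WithLp.ofLp x‖ ^ 2 ≤ c ^ 2} = centredCube 2 |c| := by
    intro c
    ext x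
    simp only [Set.mem_univ, true_and, Set.mem_ofPred_eq, centredCube]
    rw [← sq_abs c, pow_le_pow_iff_left₀ (norm_nonneg _) (abs_nonneg c) two_ne_zero,
      pi_norm_le_iff_of_nonneg (abs_nonneg c)]
    rfl
  have hset1 : {x ∈ (Set.univ : Set (EuclideanSpace ℝ (Fin 2))) |
      ‖WithLp.ofLp x‖ ^ 2 ≤ 1} = centredCube 2 1 := by
    have := hset 1
    rwa [one_pow, abs_one] at this
  have h := ZLattice.covolume.tendsto_card_le_div' L (X := Set.univ)
    (F := fun x => ‖WithLp.ofLp x‖ ^ 2) (fun _ _ _ _ => trivial)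
    (fun x r hr => by
      rw [WithLp.ofLp_smul, norm_smul, mul_pow, Real.norm_of_nonneg hr, finrank_euclideanSpace,
        Fintype.card_fin])
    (by rw [hset1]; exact isBounded_centredCube 2 1)
    (by rw [hset1]; exact measurableSet_centredCube 2 1)
    (by rw [hset1]; exact (convex_centredCube 2 1).addHaar_frontier volume)
  rw [hset1, Measure.real, volume_centredCube] at h
  have h4 : (ENNReal.ofReal (2 * 1) ^ 2).toReal = 4 := by
    rw [ENNReal.toReal_pow, ENNReal.toReal_ofReal (by norm_num)]
    norm_num
  rw [h4] at h
  refine (h.comp (tendsto_pow_atTop two_ne_zero)).congr' ?_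
  filter_upwards [eventually_ge_atTop 0] with N hN
  simp only [Function.comp_apply]
  rw [hset N, abs_of_nonneg hN, Set.inter_comm, Nat.card_coe_set_eq]

theorem infsep_inter_centredCube {v : EuclideanSpace ℝ (Fin 2)} (hv : v ∈ L) (hv0 : v ≠ 0)
    (hmin : ∀ x ∈ L, x ≠ 0 → ‖v‖ ≤ ‖x‖) {N : ℝ} (hN : ‖v‖ ≤ N) :
    ((L : Set (EuclideanSpace ℝ (Fin 2))) ∩ centredCube 2 N).infsep = ‖v‖ := by
  have h0 : (0 : EuclideanSpace ℝ (Fin 2)) ∈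
      (L : Set (EuclideanSpace ℝ (Fin 2))) ∩ centredCube 2 N :=
    ⟨L.zero_mem, fun i => by simpa using (norm_nonneg v).trans hN⟩
  have h1 : v ∈ (L : Set (EuclideanSpace ℝ (Fin 2))) ∩ centredCube 2 N :=
    ⟨hv, fun i => (PiLp.norm_apply_le v i).trans hN⟩
  refine le_antisymm ?_ ?_
  · have := (finite_inter_centredCube L N).to_subtype
    simpa using Set.infsep_le_dist_of_mem h1 h0 hv0
  · refine Set.Nontrivial.le_infsep ⟨v, h1, 0, h0, hv0⟩ fun x hx y hy hxy => ?_
    rw [dist_eq_norm]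
    exact hmin _ (L.sub_mem hx.1 hy.1) (sub_ne_zero.2 hxy)

/-- Once the box contains 0 and v the radius is r = |v|/2, and the balls are disjoint. The covered
area lies between the area of the balls centred in the box of half-side N - r, which stay inside the
box, and that of all balls centred in the box. Both bounds have the same limit, so the limsup is a
limit. -/
theorem packingDensity_eq [IsZLattice ℝ L] {v : EuclideanSpace ℝ (Fin 2)} (hv : v ∈ L)
    (hv0 : v ≠ 0) (hmin : ∀ x ∈ L, x ≠ 0 → ‖v‖ ≤ ‖x‖) :
    packingDensity (L : Set (EuclideanSpace ℝ (Fin 2))) =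
      Real.pi / 4 * ‖v‖ ^ 2 / ZLattice.covolume L := by
  set S : ℝ → Set (EuclideanSpace ℝ (Fin 2)) := fun N => (L : Set _) ∩ centredCube 2 N with hS
  have hfin : ∀ N, (S N).Finite := finite_inter_centredCube L
  set r := ‖v‖ / 2 with hr
  have hr0 : 0 ≤ r := by positivity
  have hball : ∀ x : EuclideanSpace ℝ (Fin 2), volume.real (Metric.ball x r) = Real.pi * r ^ 2 := by
    intro x
    rw [Measure.real, EuclideanSpace.volume_ball_fin_two, ENNReal.toReal_mul, ENNReal.toReal_pow,
      ENNReal.toReal_ofReal hr0, ENNReal.toReal_ofReal Real.pi_pos.le, mul_comm]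
  have hunion : ∀ N, volume.real (⋃ x ∈ S N, Metric.ball x r) = (S N).ncard * (Real.pi * r ^ 2) := by
    intro N
    have h := measureReal_biUnion_finset (μ := (volume : Measure (EuclideanSpace ℝ (Fin 2))))
      (s := (hfin N).toFinset) (f := fun x => Metric.ball x r) ?_
      (fun _ _ => measurableSet_ball) (fun _ _ => measure_ball_lt_top.ne)
    · simp only [Set.Finite.mem_toFinset] at h
      rw [h, Finset.sum_congr rfl fun x _ => hball x, Finset.sum_const, nsmul_eq_mul,
        Set.ncard_eq_toFinset_card _ (hfin N)]
    · intro x hx y hy hxy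
      refine Metric.ball_disjoint_ball ?_
      simp only [Set.Finite.coe_toFinset, hS] at hx hy
      rw [dist_eq_norm, hr, add_halves]
      exact hmin _ (L.sub_mem hx.1 hy.1) (sub_ne_zero.2 hxy)
  have hbdd : ∀ N, volume (⋃ x ∈ S N, Metric.ball x r) ≠ ⊤ := fun N =>
    (measure_biUnion_lt_top (hfin N) fun _ _ => measure_ball_lt_top).ne
  have hcard := tendsto_card_inter_centredCube L
  have hlim : Tendsto (fun N : ℝ => boxPackingDensity (L : Set (EuclideanSpace ℝ (Fin 2))) N) atTop
      (nhds (Real.pi / 4 * ‖v‖ ^ 2 / ZLattice.covolume L)) := by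
    refine tendsto_of_tendsto_of_tendsto_of_le_of_le'
      (g := fun N : ℝ => ((S (N - r)).ncard / (N - r) ^ 2 * (1 - r * N⁻¹) ^ 2) *
        (Real.pi * r ^ 2 / 4))
      (h := fun N : ℝ => ((S N).ncard / N ^ 2) * (Real.pi * r ^ 2 / 4)) ?_ ?_ ?_ ?_
    · have h0 : Tendsto (fun N : ℝ => N - r) atTop atTop := by
        simpa [sub_eq_add_neg] using tendsto_atTop_add_const_right atTop (-r) tendsto_id
      have h1 : Tendsto (fun N : ℝ => ((S (N - r)).ncard : ℝ) / (N - r) ^ 2) atTop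
          (nhds (4 / ZLattice.covolume L)) := hcard.comp h0
      have h2 : Tendsto (fun N : ℝ => (1 - r * N⁻¹) ^ 2) atTop (nhds ((1 - r * 0) ^ 2)) :=
        ((tendsto_inv_atTop_zero.const_mul r).const_sub 1).pow 2
      convert (h1.mul h2).mul_const (Real.pi * r ^ 2 / 4) using 2
      rw [mul_zero, hr]; ring
    · convert hcard.mul_const (Real.pi * r ^ 2 / 4) using 2
      rw [hr]; ring
    · filter_upwards [eventually_gt_atTop ‖v‖] with N hN
      have hNpos : 0 < N := (norm_nonneg v).trans_lt hN
      have hNr : 0 < N - r := by rw [hr]; linarith [norm_nonneg v]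
      rw [boxPackingDensity, infsep_inter_centredCube L hv hv0 hmin hN.le]
      have hsub : volume.real (⋃ x ∈ S (N - r), Metric.ball x r) ≤
          volume.real ((⋃ x ∈ S N, Metric.ball x r) ∩ centredCube 2 N) := by
        refine measureReal_mono (fun y hy => ?_)
          (measure_ne_top_of_subset Set.inter_subset_left (hbdd N))
        obtain ⟨x, hx, hxy⟩ := Set.mem_iUnion₂.1 hy
        refine ⟨Set.mem_iUnion₂.2 ⟨x, ⟨hx.1, fun i => (hx.2 i).trans (by linarith)⟩, hxy⟩,
          fun i => ?_⟩
        have h1 : |y i - x i| ≤ r := by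
          refine (PiLp.norm_apply_le (y - x) i).trans ?_
          rw [← dist_eq_norm]
          exact (Metric.mem_ball.1 hxy).le
        have h2 := hx.2 i
        have h3 := abs_add_le (y i - x i) (x i)
        rw [sub_add_cancel] at h3
        linarith
      rw [hunion] at hsub
      rw [le_div_iff₀ (by positivity)]
      refine le_trans (le_of_eq ?_) hsub
      have : 1 - r * N⁻¹ = (N - r) / N := by field_simp
      rw [this]
      field_simp
      ring
    · filter_upwards [eventually_gt_atTop ‖v‖] with N hN
      have hNpos : 0 < N := (norm_nonneg v).trans_lt hN
      rw [boxPackingDensity, infsep_inter_centredCube L hv hv0 hmin hN.le,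
        div_le_iff₀ (by positivity)]
      refine (measureReal_mono Set.inter_subset_left (hbdd N)).trans (le_of_eq ?_)
      rw [hunion N]
      field_simp
      ring
  exact hlim.limsup_eq

end PackingDensity

/-! ### Lattices as column spans, and the density on reduced frames. -/

section Lattices

theorem mem_columnLattice (g : SpecialLinearGroup (Fin 2) ℝ) (x : EuclideanSpace ℝ (Fin 2)) :
    x ∈ columnLattice g ↔ ∃ c : Fin 2 → ℤ, ∀ i, x i = g i 0 * c 0 + g i 1 * c 1 := by
  rw [columnLattice, Submodule.mem_span_range_iff_exists_fun]
  refine exists_congr fun c => ?_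
  rw [Fin.sum_univ_two]
  constructor
  · rintro rfl i
    simp [mul_comm]
  · intro h
    ext i
    simp [h i, mul_comm]

theorem columnLattice_mul_map (g : SpecialLinearGroup (Fin 2) ℝ)
    (γ : SpecialLinearGroup (Fin 2) ℤ) :
    columnLattice (g * SpecialLinearGroup.map (Int.castRingHom ℝ) γ) = columnLattice g := by
  refine le_antisymm (columnLattice_mul_le g γ) ?_
  have h := columnLattice_mul_le (g * SpecialLinearGroup.map (Int.castRingHom ℝ) γ) γ⁻¹
  rwa [mul_assoc, ← map_mul, mul_inv_cancel, map_one, mul_one] at h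

/-- The first column of a matrix of determinant one. -/
noncomputable def firstColumn (g : SpecialLinearGroup (Fin 2) ℝ) : EuclideanSpace ℝ (Fin 2) :=
  WithLp.toLp 2 fun i => g i 0

theorem norm_firstColumn_sq (g : SpecialLinearGroup (Fin 2) ℝ) :
    ‖firstColumn g‖ ^ 2 = firstNormSq g := by
  rw [EuclideanSpace.norm_sq_eq, Fin.sum_univ_two]
  simp [firstColumn, firstNormSq]

theorem firstColumn_ne_zero (g : SpecialLinearGroup (Fin 2) ℝ) : firstColumn g ≠ 0 := by
  intro h
  have := norm_firstColumn_sq g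
  rw [h, norm_zero] at this
  linarith [firstNormSq_pos g]

theorem firstColumn_mem (g : SpecialLinearGroup (Fin 2) ℝ) : firstColumn g ∈ columnLattice g :=
  Submodule.subset_span ⟨0, rfl⟩

theorem IsReducedFrame.norm_firstColumn_le {g : SpecialLinearGroup (Fin 2) ℝ}
    (hg : IsReducedFrame g) {x : EuclideanSpace ℝ (Fin 2)} (hx : x ∈ columnLattice g)
    (hx0 : x ≠ 0) : ‖firstColumn g‖ ≤ ‖x‖ := by
  obtain ⟨c, hc⟩ := (mem_columnLattice g x).1 hx
  rw [← pow_le_pow_iff_left₀ (norm_nonneg _) (norm_nonneg _) two_ne_zero, norm_firstColumn_sq,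
    EuclideanSpace.norm_sq_eq, Fin.sum_univ_two, hc, hc, Real.norm_eq_abs, Real.norm_eq_abs, sq_abs,
    sq_abs]
  have hc0 : c 0 ≠ 0 ∨ c 1 ≠ 0 := by
    by_contra! h
    refine hx0 ?_
    ext i
    simp [hc i, h.1, h.2]
  refine (le_quadraticForm_of_reduced hg.1 hg.2 hc0).trans (le_of_eq ?_)
  simp only [firstNormSq, columnInner, secondNormSq]
  ring

/-- A lattice in the plane is a dilate of a lattice with a reduced basis of determinant one. -/
theorem exists_isReducedFrame_of_isZLattice (L : Submodule ℤ (EuclideanSpace ℝ (Fin 2)))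
    [DiscreteTopology L] [IsZLattice ℝ L] (b : Module.Basis (Fin 2) ℤ L) :
    ∃ (s : ℝ) (g : SpecialLinearGroup (Fin 2) ℝ), 0 < s ∧ IsReducedFrame g ∧
      (∀ x, x ∈ L ↔ ∃ y ∈ columnLattice g, x = s • y) ∧ ZLattice.covolume L = s ^ 2 := by
  set D : ℝ := (b 0 : EuclideanSpace ℝ (Fin 2)) 0 * (b 1 : EuclideanSpace ℝ (Fin 2)) 1 -
    (b 1 : EuclideanSpace ℝ (Fin 2)) 0 * (b 0 : EuclideanSpace ℝ (Fin 2)) 1 with hD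
  have hcov : ZLattice.covolume L = |D| := by
    rw [ZLattice.covolume_eq_det_mul_measureReal L volume b
      (EuclideanSpace.basisFun (Fin 2) ℝ).toBasis,
      measureReal_congr (ZSpan.fundamentalDomain_ae_parallelepiped _ volume)]
    rw [OrthonormalBasis.coe_toBasis, Measure.real, OrthonormalBasis.volume_parallelepiped,
      ENNReal.toReal_one, mul_one, Module.Basis.det_apply, Matrix.det_fin_two]
    rfl
  have hD0 : 0 < |D| := hcov ▸ ZLattice.covolume_pos L volume
  -- The sign ε corrects the orientation of the basis without changing its ℤ-span; dividing by √|D|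
  -- then makes the determinant one.
  obtain ⟨ε, hε, hεD⟩ : ∃ ε : ℤ, ε * ε = 1 ∧ (ε : ℝ) * D = |D| := by
    rcases abs_cases D with h | h
    · exact ⟨1, by norm_num, by rw [h.1]; simp⟩
    · exact ⟨-1, by norm_num, by rw [h.1]; simp⟩
  have hεR : (ε : ℝ) * ε = 1 := by exact_mod_cast hε
  set s := √|D| with hs
  have hs0 : 0 < s := Real.sqrt_pos.2 hD0
  have hss : s ^ 2 = |D| := Real.sq_sqrt hD0.le
  let g₀ : SpecialLinearGroup (Fin 2) ℝ :=
    ⟨!![s⁻¹ * (b 0 : EuclideanSpace ℝ (Fin 2)) 0, s⁻¹ * ε * (b 1 : EuclideanSpace ℝ (Fin 2)) 0;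
        s⁻¹ * (b 0 : EuclideanSpace ℝ (Fin 2)) 1, s⁻¹ * ε * (b 1 : EuclideanSpace ℝ (Fin 2)) 1], by
      rw [Matrix.det_fin_two_of]
      field_simp
      rw [hss, ← hεD, hD]⟩
  obtain ⟨γ, hγ⟩ := exists_isReducedFrame_mul g₀
  refine ⟨s, _, hs0, hγ, fun x => ?_, by rw [hcov, hss]⟩
  have hL : x ∈ L ↔ ∃ c : Fin 2 → ℤ, x = c 0 • (b 0 : EuclideanSpace ℝ (Fin 2)) +
      c 1 • (b 1 : EuclideanSpace ℝ (Fin 2)) := by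
    constructor
    · intro hx
      refine ⟨fun i => b.repr ⟨x, hx⟩ i, ?_⟩
      have := congrArg (Subtype.val : L → EuclideanSpace ℝ (Fin 2)) (b.sum_repr ⟨x, hx⟩)
      rw [Fin.sum_univ_two] at this
      exact this.symm
    · rintro ⟨c, rfl⟩
      exact L.add_mem (L.smul_mem _ (b 0).2) (L.smul_mem _ (b 1).2)
  simp only [columnLattice_mul_map, mem_columnLattice]
  have e1 : ∀ i, g₀ i 0 = s⁻¹ * (b 0 : EuclideanSpace ℝ (Fin 2)) i := by
    intro i; fin_cases i <;> rfl
  have e2 : ∀ i, g₀ i 1 = s⁻¹ * ε * (b 1 : EuclideanSpace ℝ (Fin 2)) i := by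
    intro i; fin_cases i <;> rfl
  rw [hL]
  constructor
  · rintro ⟨c, rfl⟩
    refine ⟨s⁻¹ • (c 0 • (b 0 : EuclideanSpace ℝ (Fin 2)) + c 1 • (b 1 : EuclideanSpace ℝ (Fin 2))),
      ⟨![c 0, ε * c 1], fun i => ?_⟩, by rw [smul_inv_smul₀ hs0.ne']⟩
    rw [e1, e2]
    simp
    linear_combination (-s⁻¹ * (b 1 : EuclideanSpace ℝ (Fin 2)) i * c 1) * hεR
  · rintro ⟨y, ⟨c, hc⟩, rfl⟩
    refine ⟨![c 0, ε * c 1], ?_⟩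
    ext i
    simp only [PiLp.smul_apply, hc i, e1, e2]
    simp
    field_simp

theorem packingDensity_of_reduced (L : Submodule ℤ (EuclideanSpace ℝ (Fin 2))) [DiscreteTopology L]
    [IsZLattice ℝ L] {s : ℝ} {g : SpecialLinearGroup (Fin 2) ℝ} (hs : 0 < s)
    (hg : IsReducedFrame g) (hL : ∀ x, x ∈ L ↔ ∃ y ∈ columnLattice g, x = s • y)
    (hcov : ZLattice.covolume L = s ^ 2) :
    packingDensity (L : Set (EuclideanSpace ℝ (Fin 2))) = Real.pi / 4 * firstNormSq g := by
  have h := packingDensity_eq L (v := s • firstColumn g) ((hL _).2 ⟨_, firstColumn_mem g, rfl⟩)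
    (smul_ne_zero hs.ne' (firstColumn_ne_zero g)) ?_
  · rw [h, hcov, norm_smul, mul_pow, norm_firstColumn_sq, Real.norm_of_nonneg hs.le]
    field_simp
  · intro x hx hx0
    obtain ⟨y, hy, rfl⟩ := (hL x).1 hx
    rw [norm_smul, norm_smul]
    gcongr
    exact hg.norm_firstColumn_le hy fun h => hx0 (by rw [h, smul_zero])

/-- The columns of a matrix of determinant one form a basis of the plane. -/
theorem exists_basis_columnLattice (g : SpecialLinearGroup (Fin 2) ℝ) :
    ∃ b : Module.Basis (Fin 2) ℝ (EuclideanSpace ℝ (Fin 2)),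
      ⇑b = fun j : Fin 2 => WithLp.toLp 2 (fun i : Fin 2 => g i j) := by
  have hli : LinearIndependent ℝ
      fun j : Fin 2 => (WithLp.toLp 2 (fun i : Fin 2 => g i j) : EuclideanSpace ℝ (Fin 2)) := by
    rw [Fintype.linearIndependent_iff]
    intro c hc
    have hdet := det_SL2_eq_one g
    have h0 := congrArg (fun x : EuclideanSpace ℝ (Fin 2) => x 0) hc
    have h1 := congrArg (fun x : EuclideanSpace ℝ (Fin 2) => x 1) hc
    simp [Fin.sum_univ_two] at h0 h1
    intro i
    fin_cases i
    · simp only [Fin.zero_eta]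
      linear_combination (g 1 1) * h0 - (g 0 1) * h1 - c 0 * hdet
    · simp only [Fin.mk_one]
      linear_combination (g 0 0) * h1 - (g 1 0) * h0 - c 1 * hdet
  exact ⟨basisOfLinearIndependentOfCardEqFinrank hli (by simp), by simp⟩

theorem discreteTopology_columnLattice (g : SpecialLinearGroup (Fin 2) ℝ) :
    DiscreteTopology (columnLattice g) := by
  obtain ⟨b, hb⟩ := exists_basis_columnLattice g
  rw [columnLattice, ← hb]
  infer_instance

theorem isZLattice_columnLattice (g : SpecialLinearGroup (Fin 2) ℝ)
    [DiscreteTopology (columnLattice g)] : IsZLattice ℝ (columnLattice g) := by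
  obtain ⟨b, hb⟩ := exists_basis_columnLattice g
  refine ⟨?_⟩
  rw [columnLattice, ← hb, Submodule.span_span_of_tower, b.span_eq]

theorem covolume_columnLattice (g : SpecialLinearGroup (Fin 2) ℝ)
    [DiscreteTopology (columnLattice g)] [IsZLattice ℝ (columnLattice g)] :
    ZLattice.covolume (columnLattice g) = 1 := by
  obtain ⟨b, hb⟩ := exists_basis_columnLattice g
  have hdom := ZSpan.isAddFundamentalDomain b (volume : Measure (EuclideanSpace ℝ (Fin 2)))
  have hspan : Submodule.span ℤ (Set.range b) = columnLattice g := by rw [columnLattice, hb]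
  rw [hspan] at hdom
  rw [ZLattice.covolume_eq_measure_fundamentalDomain _ volume hdom,
    ZSpan.measureReal_fundamentalDomain b volume (EuclideanSpace.basisFun (Fin 2) ℝ).toBasis,
    measureReal_congr (ZSpan.fundamentalDomain_ae_parallelepiped _ volume),
    OrthonormalBasis.coe_toBasis, Measure.real, OrthonormalBasis.volume_parallelepiped,
    ENNReal.toReal_one, mul_one, Module.Basis.det_apply, Matrix.det_fin_two, hb]
  change |g 0 0 * g 1 1 - g 0 1 * g 1 0| = 1
  rw [det_SL2_eq_one, abs_one]

theorem latticeDensity_mk (g : SpecialLinearGroup (Fin 2) ℝ) :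
    latticeDensity (g : SpecialLinearGroup (Fin 2) ℝ ⧸ SL2Z) =
      packingDensity (columnLattice g : Set (EuclideanSpace ℝ (Fin 2))) := rfl

theorem IsReducedFrame.latticeDensity_eq {g : SpecialLinearGroup (Fin 2) ℝ}
    (hg : IsReducedFrame g) :
    latticeDensity (g : SpecialLinearGroup (Fin 2) ℝ ⧸ SL2Z) = Real.pi / 4 * firstNormSq g := by
  have := discreteTopology_columnLattice g
  have := isZLattice_columnLattice g
  rw [latticeDensity_mk]
  refine packingDensity_of_reduced _ one_pos hg (fun x => by simp) ?_
  rw [covolume_columnLattice, one_pow]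

theorem IsReducedFrame.pi_div_four_mul_firstNormSq_le {g : SpecialLinearGroup (Fin 2) ℝ}
    (hg : IsReducedFrame g) : Real.pi / 4 * firstNormSq g ≤ Real.pi / √12 := by
  have h := hg.firstNormSq_sq_le
  have h12 : √12 ^ 2 = (12 : ℝ) := Real.sq_sqrt (by norm_num)
  have hs : (0 : ℝ) < √12 := by positivity
  rw [le_div_iff₀ hs]
  have h2 : firstNormSq g * √12 ≤ 4 := by
    rw [← pow_le_pow_iff_left₀ (mul_pos (firstNormSq_pos g) hs).le (by norm_num) two_ne_zero,
      mul_pow, h12]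
    linarith
  nlinarith [Real.pi_pos]

/-- A reduced basis of the unimodular hexagonal lattice. -/
theorem exists_isReducedFrame_hexagonal :
    ∃ g : SpecialLinearGroup (Fin 2) ℝ, IsReducedFrame g ∧
      Real.pi / 4 * firstNormSq g = Real.pi / √12 := by
  have h3 : √3 ^ 2 = (3 : ℝ) := Real.sq_sqrt (by norm_num)
  have hs3 : (0 : ℝ) < √3 := by positivity
  have h12 : √12 = 2 * √3 := by
    rw [show (12 : ℝ) = 2 ^ 2 * 3 by norm_num, Real.sqrt_mul (by norm_num),
      Real.sqrt_sq (by norm_num)]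
  -- Columns (α, 0) and (α/2, 1/α): with α² = 2/√3 both have squared length 2/√3 and their inner
  -- product is half of that.
  set α := √(2 / √3) with hα
  have hα2 : α ^ 2 = 2 / √3 := Real.sq_sqrt (by positivity)
  have hα0 : 0 < α := Real.sqrt_pos.2 (by positivity)
  have hinv : (1 / α) ^ 2 = √3 / 2 := by rw [div_pow, hα2]; field_simp
  refine ⟨⟨!![α, α / 2; 0, 1 / α], by rw [Matrix.det_fin_two_of]; field_simp; ring⟩, ⟨?_, ?_⟩, ?_⟩
  · change 2 * |α * (α / 2) + 0 * (1 / α)| ≤ α ^ 2 + 0 ^ 2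
    rw [abs_of_pos (by positivity)]
    nlinarith
  · change α ^ 2 + 0 ^ 2 ≤ (α / 2) ^ 2 + (1 / α) ^ 2
    rw [hinv, div_pow, hα2]
    field_simp
    nlinarith
  · change Real.pi / 4 * (α ^ 2 + 0 ^ 2) = _
    rw [hα2, h12]
    field_simp
    norm_num

theorem mk_mul_map (g : SpecialLinearGroup (Fin 2) ℝ) (γ : SpecialLinearGroup (Fin 2) ℤ) :
    ((g * SpecialLinearGroup.map (Int.castRingHom ℝ) γ : SpecialLinearGroup (Fin 2) ℝ) :
      SpecialLinearGroup (Fin 2) ℝ ⧸ SL2Z) = g :=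
  QuotientGroup.mk_mul_of_mem g ⟨γ, rfl⟩

/-- The first column of any frame is at least as long as that of a reduced frame of the same
lattice. The density is thus an infimum over `SL2Z`, which gives its measurability. -/
theorem latticeDensity_mk_le (g : SpecialLinearGroup (Fin 2) ℝ) :
    latticeDensity (g : SpecialLinearGroup (Fin 2) ℝ ⧸ SL2Z) ≤ Real.pi / 4 * firstNormSq g := by
  obtain ⟨γ, hγ⟩ := exists_isReducedFrame_mul g
  rw [← mk_mul_map g γ, hγ.latticeDensity_eq]
  have h := hγ.firstNormSq_le γ⁻¹
  rw [mul_assoc, ← map_mul, mul_inv_cancel, map_one, mul_one] at h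
  have := Real.pi_pos
  gcongr

end Lattices

/-! ### Radial integration in the plane. -/

section RadialIntegration

theorem volume_normSq_lt (b : ℝ) :
    volume {v : Fin 2 → ℝ | Real.pi / 4 * (v 0 ^ 2 + v 1 ^ 2) < b} = ENNReal.ofReal (4 * b) := by
  have hpi := Real.pi_pos
  have h := (PiLp.volume_preserving_toLp (Fin 2)).measure_preimage
    (s := Metric.ball (0 : EuclideanSpace ℝ (Fin 2)) (√(4 * b / Real.pi)))
    measurableSet_ball.nullMeasurableSet
  rw [EuclideanSpace.volume_ball_fin_two, ← ENNReal.ofReal_pow (Real.sqrt_nonneg _),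
    ← ENNReal.ofReal_mul (sq_nonneg _)] at h
  rcases le_or_gt b 0 with hb | hb
  · rw [ENNReal.ofReal_of_nonpos (by linarith)]
    convert measure_empty (μ := (volume : Measure (Fin 2 → ℝ)))
    refine Set.eq_empty_of_forall_notMem fun v hv => ?_
    have h1 : Real.pi / 4 * (v 0 ^ 2 + v 1 ^ 2) < b := hv
    have : 0 ≤ Real.pi / 4 * (v 0 ^ 2 + v 1 ^ 2) := by positivity
    linarith
  · rw [Real.sq_sqrt (by positivity), div_mul_cancel₀ _ hpi.ne'] at h
    rw [← h]
    congr 1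
    ext v
    simp only [Set.mem_ofPred_eq, Set.mem_preimage, mem_ball_zero_iff]
    rw [EuclideanSpace.norm_eq, Real.sqrt_lt_sqrt_iff (by positivity), Fin.sum_univ_two,
      lt_div_iff₀ hpi]
    simp only [Real.norm_eq_abs, sq_abs]
    constructor <;> intro h <;> linarith

/-- Two measures on the line agree once they agree on half-open intervals. The disc where π|v|²/4 <
b has area 4b for b > 0, so the image of area is 4 dx on the positive axis. -/
theorem map_normSq_volume :
    (volume : Measure (Fin 2 → ℝ)).map (fun v => Real.pi / 4 * (v 0 ^ 2 + v 1 ^ 2)) =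
      ENNReal.ofReal 4 • volume.restrict (Set.Ioi 0) := by
  have hmeas : Measurable fun v : Fin 2 → ℝ => Real.pi / 4 * (v 0 ^ 2 + v 1 ^ 2) := by fun_prop
  have : IsLocallyFiniteMeasure (ENNReal.ofReal 4 • (volume : Measure ℝ).restrict (Set.Ioi 0)) :=
    inferInstanceAs (IsLocallyFiniteMeasure (Real.toNNReal 4 • volume.restrict (Set.Ioi 0)))
  refine (Measure.ext_of_Ico _ _ fun a b hab => ?_).symm
  rw [Measure.map_apply hmeas measurableSet_Ico, Measure.smul_apply,
    Measure.restrict_apply measurableSet_Ico]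
  have h1 : (fun v : Fin 2 → ℝ => Real.pi / 4 * (v 0 ^ 2 + v 1 ^ 2)) ⁻¹' Set.Ico a b =
      {v : Fin 2 → ℝ | Real.pi / 4 * (v 0 ^ 2 + v 1 ^ 2) < b} \
        {v : Fin 2 → ℝ | Real.pi / 4 * (v 0 ^ 2 + v 1 ^ 2) < a} := by
    ext v
    simp [and_comm]
  have hsub : {v : Fin 2 → ℝ | Real.pi / 4 * (v 0 ^ 2 + v 1 ^ 2) < a} ⊆
      {v : Fin 2 → ℝ | Real.pi / 4 * (v 0 ^ 2 + v 1 ^ 2) < b} := fun v hv => lt_trans hv hab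
  rw [h1, measure_sdiff hsub
    (measurableSet_lt hmeas measurable_const).nullMeasurableSet (by rw [volume_normSq_lt]; exact ENNReal.ofReal_ne_top),
    volume_normSq_lt, volume_normSq_lt, smul_eq_mul]
  have h2 : volume (Set.Ico a b ∩ Set.Ioi (0 : ℝ)) = ENNReal.ofReal (b - max a 0) := by
    rcases le_or_gt a 0 with ha | ha
    · have : Set.Ico a b ∩ Set.Ioi (0 : ℝ) = Set.Ioo 0 b := by
        ext x
        simp only [Set.mem_inter_iff, Set.mem_Ico, Set.mem_Ioi, Set.mem_Ioo]
        constructor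
        · rintro ⟨⟨_, h⟩, h'⟩; exact ⟨h', h⟩
        · rintro ⟨h, h'⟩; exact ⟨⟨by linarith, h'⟩, h⟩
      rw [this, Real.volume_Ioo, max_eq_right ha]
    · have : Set.Ico a b ⊆ Set.Ioi 0 := fun x hx => ha.trans_le hx.1
      rw [Set.inter_eq_left.2 this, Real.volume_Ico, max_eq_left ha.le]
  rw [h2, ← ENNReal.ofReal_mul (by norm_num)]
  rcases le_or_gt a 0 with ha | ha
  · rw [max_eq_right ha, sub_zero, ENNReal.ofReal_of_nonpos (p := 4 * a) (by linarith), tsub_zero]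
  · rw [max_eq_left ha.le, ← ENNReal.ofReal_sub _ (by linarith), mul_sub]

theorem lintegral_comp_normSq {F : ℝ → ENNReal} (hF : Measurable F) :
    ∫⁻ v : Fin 2 → ℝ, F (Real.pi / 4 * (v 0 ^ 2 + v 1 ^ 2)) =
      ENNReal.ofReal 4 * ∫⁻ x in Set.Ioi 0, F x := by
  rw [← lintegral_map hF (by fun_prop), map_normSq_volume, lintegral_smul_measure, smul_eq_mul]

end RadialIntegration

/-! ### The target density as the length of a slice. -/

section DensityFun

theorem measurable_densityFun : Measurable densityFun := by
  unfold densityFun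
  refine Measurable.ite measurableSet_Iio measurable_const ?_
  refine Measurable.ite measurableSet_Iic measurable_const ?_
  refine Measurable.ite measurableSet_Iic ?_ measurable_const
  fun_prop

theorem sqrt_twelve : √12 = 2 * √3 := by
  rw [show (12 : ℝ) = 2 ^ 2 * 3 by norm_num, Real.sqrt_mul (by norm_num),
    Real.sqrt_sq (by norm_num)]

theorem pi_div_sqrt_twelve_sq : (Real.pi / √12) ^ 2 = Real.pi ^ 2 / 12 := by
  rw [div_pow, Real.sq_sqrt (by norm_num)]

theorem pi_div_four_lt_pi_div_sqrt_twelve : Real.pi / 4 < Real.pi / √12 := by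
  have : √12 < 4 := by
    rw [Real.sqrt_lt' (by norm_num)]
    norm_num
  have h : (0 : ℝ) < √12 := by positivity
  exact div_lt_div_of_pos_left Real.pi_pos h this

/-- One formula covers all three pieces: the real square root vanishes on negative arguments, which
handles x ≤ π/4, and `ENNReal.ofReal` truncates the negative values beyond π/√12. -/
theorem ofReal_densityFun {x : ℝ} (hx : 0 < x) :
    ENNReal.ofReal (densityFun x) = ENNReal.ofReal (12 / Real.pi ^ 2) *
      ENNReal.ofReal (1 - 2 * √(1 - (Real.pi / (4 * x)) ^ 2)) := by
  have hpi := Real.pi_pos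
  rw [← ENNReal.ofReal_mul (by positivity), densityFun, if_neg hx.le.not_gt]
  split_ifs with h1 h2
  · have : 1 - (Real.pi / (4 * x)) ^ 2 ≤ 0 := by
      have : 1 ≤ Real.pi / (4 * x) := by
        rw [le_div_iff₀ (by positivity)]
        linarith
      nlinarith
    rw [Real.sqrt_eq_zero_of_nonpos this]
    simp
  · rfl
  · symm
    rw [ENNReal.ofReal_zero]
    refine ENNReal.ofReal_of_nonpos (mul_nonpos_of_nonneg_of_nonpos (by positivity) ?_)
    have h3 : Real.pi ^ 2 / 12 < x ^ 2 := by
      rw [← pi_div_sqrt_twelve_sq]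
      push Not at h2
      gcongr
    have h4 : (1 / 2 : ℝ) ^ 2 ≤ 1 - (Real.pi / (4 * x)) ^ 2 := by
      have h5 : (Real.pi / (4 * x)) ^ 2 ≤ 3 / 4 := by
        rw [div_pow, div_le_iff₀ (by positivity)]
        nlinarith
      linarith
    have := Real.le_sqrt_of_sq_le h4
    linarith

theorem volume_strictlyReduced_shifts {n : ℝ} (hn : 0 < n) :
    volume {t : ℝ | 2 * |t * n| < n ∧ n < t ^ 2 * n + 1 / n} =
      ENNReal.ofReal (1 - 2 * √(1 - (1 / n) ^ 2)) := by
  set u := √(1 - (1 / n) ^ 2) with hu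
  have hu0 : 0 ≤ u := Real.sqrt_nonneg _
  have h1 : ({t : ℝ | 2 * |t * n| < n ∧ n < t ^ 2 * n + 1 / n} : Set ℝ) =ᵐ[volume]
      (Set.Ioo (-(1 / 2)) (-u) ∪ Set.Ioo u (1 / 2) : Set ℝ) := by
    -- For n < 1 the point t = 0 satisfies the left conditions, while u = 0 excludes it on the
    -- right, so equality holds only almost everywhere.
    filter_upwards [Measure.ae_ne volume (0 : ℝ)] with t ht
    refine propext ?_
    change (2 * |t * n| < n ∧ n < t ^ 2 * n + 1 / n) ↔
      t ∈ Set.Ioo (-(1 / 2)) (-u) ∪ Set.Ioo u (1 / 2)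
    have e1 : 2 * |t * n| < n ↔ |t| < 1 / 2 := by
      rw [abs_mul, abs_of_pos hn]
      constructor
      · intro h
        by_contra! hc
        nlinarith
      · intro h
        nlinarith
    have e2 : n < t ^ 2 * n + 1 / n ↔ u < |t| := by
      rw [hu, Real.sqrt_lt' (abs_pos.2 ht), sq_abs]
      have : n < t ^ 2 * n + 1 / n ↔ n * 1 < n * (t ^ 2 + (1 / n) ^ 2) := by
        rw [mul_one]
        have : n * (t ^ 2 + (1 / n) ^ 2) = t ^ 2 * n + 1 / n := by field_simp
        rw [this]
      rw [this, mul_lt_mul_iff_right₀ hn, sub_lt_iff_lt_add]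
    rw [e1, e2, abs_lt, lt_abs]
    simp only [Set.mem_union, Set.mem_Ioo]
    constructor
    · rintro ⟨⟨h1, h2⟩, h | h⟩
      · exact Or.inr ⟨h, h2⟩
      · exact Or.inl ⟨h1, by linarith⟩
    · rintro (⟨h1, h2⟩ | ⟨h1, h2⟩)
      · exact ⟨⟨h1, by linarith⟩, Or.inr (by linarith)⟩
      · exact ⟨⟨by linarith, h2⟩, Or.inl h1⟩
  rw [measure_congr h1, measure_union _ measurableSet_Ioo, Real.volume_Ioo, Real.volume_Ioo]
  · rcases le_or_gt u (1 / 2) with h | h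
    · rw [← ENNReal.ofReal_add (by linarith) (by linarith)]
      congr 1
      ring
    · rw [ENNReal.ofReal_of_nonpos (by linarith), ENNReal.ofReal_of_nonpos (by linarith),
        ENNReal.ofReal_of_nonpos (by linarith), add_zero]
  · rw [Set.disjoint_left]
    rintro t ⟨_, h2⟩ ⟨h3, _⟩
    linarith

end DensityFun

/-! ### The law of the density, up to a constant. -/

section Distribution

variable [MeasurableSpace (SpecialLinearGroup (Fin 2) ℝ)] [BorelSpace (SpecialLinearGroup (Fin 2) ℝ)]

theorem measurableSet_isReducedFrame : MeasurableSet {g | IsReducedFrame g} :=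
  (measurableSet_le (continuous_columnInner.measurable.norm.const_mul 2)
    continuous_firstNormSq.measurable).inter
    (measurableSet_le continuous_firstNormSq.measurable continuous_secondNormSq.measurable)

theorem measurableSet_isStrictlyReducedFrame : MeasurableSet {g | IsStrictlyReducedFrame g} :=
  (measurableSet_lt (continuous_columnInner.measurable.norm.const_mul 2)
    continuous_firstNormSq.measurable).inter
    (measurableSet_lt continuous_firstNormSq.measurable continuous_secondNormSq.measurable)

theorem haarSL2_apply {A : Set (SpecialLinearGroup (Fin 2) ℝ)} (hA : MeasurableSet A) :
    haarSL2 A = ∫⁻ v : Fin 2 → ℝ, volume {t : ℝ | frame (v, t) ∈ A} := by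
  rw [← lintegral_indicator_one hA, lintegral_haarSL2 (measurable_one.indicator hA)]
  refine lintegral_congr fun v => ?_
  exact lintegral_indicator_one ((measurable_frame.comp measurable_prodMk_left) hA)

/-- For fixed v ≠ 0, equality in one of the two reduction inequalities leaves at most four values of
t. -/
theorem haarSL2_reduced_not_strictlyReduced :
    haarSL2 ({g | IsReducedFrame g} \ {g | IsStrictlyReducedFrame g}) = 0 := by
  rw [haarSL2_apply (measurableSet_isReducedFrame.diff measurableSet_isStrictlyReducedFrame),
    lintegral_eq_zero_iff' ?_]
  · filter_upwards [Measure.ae_ne volume (0 : Fin 2 → ℝ)] with v hv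
    set n := v 0 ^ 2 + v 1 ^ 2 with hn
    have hn0 : 0 < n := lt_of_le_of_ne (by positivity) (normSq_ne_zero hv).symm
    refine Set.Finite.measure_zero (Set.Finite.subset
      (s := {1 / 2, -(1 / 2), √(1 - (1 / n) ^ 2), -√(1 - (1 / n) ^ 2)}) (Set.toFinite _) ?_) _
    rintro t ⟨⟨h1, h2⟩, h3⟩
    rw [columnInner_frame hv, firstNormSq_frame hv, ← hn, abs_mul, abs_of_pos hn0] at h1
    rw [firstNormSq_frame hv, secondNormSq_frame hv, ← hn] at h2
    have h4 : 2 * (|t| * n) = n ∨ n = t ^ 2 * n + 1 / n := by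
      by_contra! hc
      refine h3 ⟨?_, ?_⟩
      · rw [columnInner_frame hv, firstNormSq_frame hv, ← hn, abs_mul, abs_of_pos hn0]
        exact lt_of_le_of_ne h1 hc.1
      · rw [firstNormSq_frame hv, secondNormSq_frame hv, ← hn]
        exact lt_of_le_of_ne h2 hc.2
    simp only [Set.mem_insert_iff, Set.mem_singleton_iff]
    rcases h4 with h4 | h4
    · have h5 : |t| = 1 / 2 := by
        refine mul_right_cancel₀ hn0.ne' ?_
        linarith
      rcases (abs_eq (by norm_num)).1 h5 with h | h <;> simp [h]
    · have h5 : 1 - (1 / n) ^ 2 = t ^ 2 := by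
        field_simp at h4 ⊢
        linarith
      rw [h5, Real.sqrt_sq_eq_abs]
      rcases abs_cases t with h | h <;> rw [h.1] <;> simp
  · have hm := measurable_frame
      (measurableSet_isReducedFrame.diff measurableSet_isStrictlyReducedFrame)
    exact (measurable_measure_prodMk_left hm).aemeasurable

/-- Integrate the length of the t-slice over v and pass to x = π|v|²/4. The factor π²/3 is the
Jacobian 4 divided by the normalisation 12/π² of the density. -/
theorem haarSL2_strictlyReduced {S : Set ℝ} (hS : MeasurableSet S) :
    haarSL2 ({g | IsStrictlyReducedFrame g} ∩ {g | Real.pi / 4 * firstNormSq g ∈ S}) =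
      ENNReal.ofReal (Real.pi ^ 2 / 3) *
        ∫⁻ x in S, ENNReal.ofReal (densityFun x) := by
  have hpi := Real.pi_pos
  have hm : MeasurableSet
      ({g | IsStrictlyReducedFrame g} ∩ {g | Real.pi / 4 * firstNormSq g ∈ S}) :=
    measurableSet_isStrictlyReducedFrame.inter ((continuous_firstNormSq.measurable.const_mul _) hS)
  set F : ℝ → ENNReal := S.indicator fun x =>
    ENNReal.ofReal (1 - 2 * √(1 - (Real.pi / (4 * x)) ^ 2)) with hF
  have hFm : Measurable F := Measurable.indicator (by fun_prop) hS
  have h1 : haarSL2 ({g | IsStrictlyReducedFrame g} ∩ {g | Real.pi / 4 * firstNormSq g ∈ S}) =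
      ∫⁻ v : Fin 2 → ℝ, F (Real.pi / 4 * (v 0 ^ 2 + v 1 ^ 2)) := by
    rw [haarSL2_apply hm]
    refine lintegral_congr_ae ?_
    filter_upwards [Measure.ae_ne volume (0 : Fin 2 → ℝ)] with v hv
    have hn0 : 0 < v 0 ^ 2 + v 1 ^ 2 := lt_of_le_of_ne (by positivity) (normSq_ne_zero hv).symm
    simp only [Set.mem_inter_iff, Set.mem_ofPred_eq, IsStrictlyReducedFrame, columnInner_frame hv,
      firstNormSq_frame hv, secondNormSq_frame hv]
    by_cases hvS : Real.pi / 4 * (v 0 ^ 2 + v 1 ^ 2) ∈ S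
    · simp only [hvS, and_true, hF, Set.indicator_of_mem]
      rw [volume_strictlyReduced_shifts hn0]
      congr 6
      field_simp
    · simp [hvS, hF]
  rw [h1, lintegral_comp_normSq hFm]
  have h2 : ∫⁻ x in S, ENNReal.ofReal (densityFun x) =
      ENNReal.ofReal (12 / Real.pi ^ 2) * ∫⁻ x in Set.Ioi 0, F x := by
    rw [← lintegral_const_mul _ hFm, ← lintegral_indicator hS, ← lintegral_indicator measurableSet_Ioi]
    refine lintegral_congr_ae ?_
    filter_upwards [Measure.ae_ne volume (0 : ℝ)] with x hx
    rcases lt_or_gt_of_ne hx with h | h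
    · have : x ∉ Set.Ioi (0 : ℝ) := h.not_gt
      rw [Set.indicator_of_notMem this]
      simp [densityFun, h]
    · rw [Set.indicator_of_mem (Set.mem_Ioi.2 h)]
      by_cases hxS : x ∈ S
      · rw [Set.indicator_of_mem hxS, hF, Set.indicator_of_mem hxS, ofReal_densityFun h]
      · simp [hF, hxS]
  rw [h2, ← mul_assoc, ← ENNReal.ofReal_mul (by positivity)]
  congr 2
  field_simp
  norm_num

theorem cosetCount_strictlyReduced {g : SpecialLinearGroup (Fin 2) ℝ}
    (hg : IsStrictlyReducedFrame g) :
    cosetCount SL2Z (g : SpecialLinearGroup (Fin 2) ℝ ⧸ SL2Z) {g | IsStrictlyReducedFrame g} =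
      2 := by
  have hneg : SpecialLinearGroup.map (Int.castRingHom ℝ) (-1 : SpecialLinearGroup (Fin 2) ℤ) =
      -1 := by
    ext i j
    fin_cases i <;> fin_cases j <;> simp
  let ε : SL2Z := ⟨-1, ⟨-1, hneg⟩⟩
  have hε : (1 : SL2Z) ≠ ε := by
    intro h
    have h1 := congrArg (fun γ : SL2Z => (γ : SpecialLinearGroup (Fin 2) ℝ) 0 0) h
    simp [ε] at h1
    linarith
  have hgε : IsStrictlyReducedFrame (g * (ε : SpecialLinearGroup (Fin 2) ℝ)) := by
    have e : g * (ε : SpecialLinearGroup (Fin 2) ℝ) = -g := by simp [ε]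
    rw [e]
    simpa [IsStrictlyReducedFrame, columnInner, firstNormSq, secondNormSq] using hg
  rw [cosetCount_mk_apply _ _ measurableSet_isStrictlyReducedFrame,
    tsum_eq_sum (s := {1, ε}), Finset.sum_pair hε]
  · rw [Set.indicator_of_mem (by simpa using hg),
      Set.indicator_of_mem (s := {g | IsStrictlyReducedFrame g}) hgε]
    simp [one_add_one_eq_two]
  · rintro ⟨_, γ, rfl⟩ hγ
    refine Set.indicator_of_notMem (fun h => hγ ?_) _
    rcases eq_one_or_neg_one_of_isStrictlyReducedFrame hg h with rfl | rfl
    · simp [Subtype.ext_iff]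
    · simp [Subtype.ext_iff, ε]

variable [MeasurableSpace (SpecialLinearGroup (Fin 2) ℝ ⧸ SL2Z)]
  [BorelSpace (SpecialLinearGroup (Fin 2) ℝ ⧸ SL2Z)]

/-- The density is the minimum of π/4 times the squared first column over all frames of the coset,
so each strict sublevel set pulls back to a countable union of measurable sets. -/
theorem measurable_latticeDensity_of_borelSpace : Measurable latticeDensity := by
  refine measurable_of_measurable_comp_mk SL2Z (measurable_of_Iio fun c => ?_)
  have h : (fun g : SpecialLinearGroup (Fin 2) ℝ => latticeDensity
      (g : SpecialLinearGroup (Fin 2) ℝ ⧸ SL2Z)) ⁻¹' Set.Iio c =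
      ⋃ γ : SL2Z, {g | Real.pi / 4 * firstNormSq (g * (γ : SpecialLinearGroup (Fin 2) ℝ)) < c} := by
    ext g
    simp only [Set.mem_preimage, Set.mem_Iio, Set.mem_iUnion, Set.mem_ofPred_eq]
    constructor
    · intro hg
      obtain ⟨γ, hγ⟩ := exists_isReducedFrame_mul g
      refine ⟨⟨_, γ, rfl⟩, ?_⟩
      rwa [← hγ.latticeDensity_eq, mk_mul_map]
    · rintro ⟨⟨_, γ, rfl⟩, hγ⟩
      rw [← mk_mul_map g γ]
      exact (latticeDensity_mk_le _).trans_lt hγ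
  rw [h]
  refine MeasurableSet.iUnion fun γ => measurableSet_lt ?_ measurable_const
  exact (continuous_firstNormSq.measurable.comp (measurable_mul_const _)).const_mul _

variable (μ : Measure (SpecialLinearGroup (Fin 2) ℝ ⧸ SL2Z)) [IsFiniteMeasure μ]
  [SMulInvariantMeasure (SpecialLinearGroup (Fin 2) ℝ) (SpecialLinearGroup (Fin 2) ℝ ⧸ SL2Z) μ]

/-- The unfolded measure does not charge the reduced frames that are not strictly reduced, so almost
no coset contains one. The reduced frame that exists in every coset is then strictly reduced. -/
theorem ae_cosetCount_strictlyReduced :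
    ∀ᵐ q ∂μ, cosetCount SL2Z q {g | IsStrictlyReducedFrame g} = 2 := by
  obtain ⟨c, hc⟩ := exists_unfoldMeasure_eq_smul_haarSL2 μ
  have hm := measurableSet_isReducedFrame.diff measurableSet_isStrictlyReducedFrame
  have h0 : unfoldMeasure SL2Z μ
      ({g | IsReducedFrame g} \ {g | IsStrictlyReducedFrame g}) = 0 := by
    rw [hc, Measure.smul_apply, haarSL2_reduced_not_strictlyReduced, smul_zero]
  rw [unfoldMeasure_apply _ _ hm, lintegral_eq_zero_iff (f := fun q => cosetCount SL2Z q
    ({g | IsReducedFrame g} \ {g | IsStrictlyReducedFrame g}))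
    ((Measure.measurable_coe hm).comp (measurable_cosetCount SL2Z))] at h0
  filter_upwards [h0] with q hq
  induction q using QuotientGroup.induction_on with
  | H g =>
    obtain ⟨γ, hγ⟩ := exists_isReducedFrame_mul g
    rw [← mk_mul_map g γ] at hq ⊢
    refine cosetCount_strictlyReduced ?_
    by_contra hns
    rw [Pi.zero_apply, cosetCount_mk_apply _ _ hm, ENNReal.tsum_eq_zero] at hq
    have := hq 1
    rw [Subgroup.coe_one, mul_one, Set.indicator_of_mem
      (s := {g | IsReducedFrame g} \ {g | IsStrictlyReducedFrame g}) ⟨hγ, hns⟩] at this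
    exact one_ne_zero this

theorem exists_map_latticeDensity_eq :
    ∃ C : ENNReal, μ.map latticeDensity =
      C • volume.withDensity fun x => ENNReal.ofReal (densityFun x) := by
  obtain ⟨c, hc⟩ := exists_unfoldMeasure_eq_smul_haarSL2 μ
  -- The factor 1/2 compensates for g and -g both being counted in each coset.
  refine ⟨2⁻¹ * (c * ENNReal.ofReal (Real.pi ^ 2 / 3)), ?_⟩
  ext S hS
  have hΔ : Measurable latticeDensity := measurable_latticeDensity_of_borelSpace
  have hA : MeasurableSet
      ({g | IsStrictlyReducedFrame g} ∩ {g | Real.pi / 4 * firstNormSq g ∈ S}) :=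
    measurableSet_isStrictlyReducedFrame.inter ((continuous_firstNormSq.measurable.const_mul _) hS)
  have h1 : unfoldMeasure SL2Z μ
      ({g | IsStrictlyReducedFrame g} ∩ {g | Real.pi / 4 * firstNormSq g ∈ S}) =
      2 * μ (latticeDensity ⁻¹' S) := by
    rw [unfoldMeasure_apply _ _ hA, ← lintegral_indicator_const (hΔ hS)]
    refine lintegral_congr_ae ?_
    filter_upwards [ae_cosetCount_strictlyReduced μ] with q hq
    induction q using QuotientGroup.induction_on with
    | H g =>
      have hfib : ∀ γ : SL2Z, IsStrictlyReducedFrame (g * (γ : SpecialLinearGroup (Fin 2) ℝ)) →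
          Real.pi / 4 * firstNormSq (g * (γ : SpecialLinearGroup (Fin 2) ℝ)) =
            latticeDensity (g : SpecialLinearGroup (Fin 2) ℝ ⧸ SL2Z) := by
        intro γ hγ
        rw [← hγ.isReducedFrame.latticeDensity_eq, QuotientGroup.mk_mul_of_mem g γ.2]
      rw [cosetCount_mk_apply _ _ hA]
      rw [cosetCount_mk_apply _ _ measurableSet_isStrictlyReducedFrame] at hq
      by_cases hg : latticeDensity (g : SpecialLinearGroup (Fin 2) ℝ ⧸ SL2Z) ∈ S
      · rw [Set.indicator_of_mem (s := latticeDensity ⁻¹' S) hg, ← hq]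
        refine tsum_congr fun γ => ?_
        by_cases hγ : IsStrictlyReducedFrame (g * (γ : SpecialLinearGroup (Fin 2) ℝ))
        · rw [Set.indicator_of_mem (s := {g | IsStrictlyReducedFrame g}) hγ, Set.indicator_of_mem]
          exact ⟨hγ, by rw [Set.mem_ofPred_eq, hfib γ hγ]; exact hg⟩
        · rw [Set.indicator_of_notMem (s := {g | IsStrictlyReducedFrame g}) hγ,
            Set.indicator_of_notMem]
          exact fun h => hγ h.1
      · rw [Set.indicator_of_notMem (s := latticeDensity ⁻¹' S) hg, ENNReal.tsum_eq_zero]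
        refine fun γ => Set.indicator_of_notMem (fun h => hg ?_) _
        rw [← hfib γ h.1]
        exact h.2
  rw [Measure.map_apply hΔ hS, Measure.smul_apply, withDensity_apply _ hS, smul_eq_mul, mul_assoc,
    mul_assoc, ← haarSL2_strictlyReduced hS, ← smul_eq_mul c, ← Measure.smul_apply, ← hc, h1,
    ← mul_assoc, ENNReal.inv_mul_cancel (by norm_num) (by norm_num), one_mul]

end Distribution

/-! ### Total mass, mean and second moment of the density. -/

section Moments

theorem pi_div_sqrt_twelve_eq : Real.pi / √12 = 2 * (Real.pi / 4) / √3 := by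
  have : (0 : ℝ) < √3 := by positivity
  rw [sqrt_twelve]
  field_simp
  norm_num

theorem densityFun_eq_indicator (x : ℝ) :
    densityFun x = 12 / Real.pi ^ 2 * ((Set.Icc 0 (Real.pi / √12)).indicator 1 x -
      2 * (Set.Icc (Real.pi / 4) (Real.pi / √12)).indicator
        (fun x => √(1 - (Real.pi / 4 / x) ^ 2)) x) := by
  have hpi := Real.pi_pos
  have hlt := pi_div_four_lt_pi_div_sqrt_twelve
  have e : Real.pi / (4 * x) = Real.pi / 4 / x := by rw [div_div]
  unfold densityFun
  split_ifs with h1 h2 h3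
  · have h4 : x ∉ Set.Icc 0 (Real.pi / √12) := fun h => h.1.not_gt h1
    have h5 : x ∉ Set.Icc (Real.pi / 4) (Real.pi / √12) := fun h => by linarith [h.1]
    rw [Set.indicator_of_notMem h4, Set.indicator_of_notMem h5]
    simp
  · have h4 : x ∈ Set.Icc 0 (Real.pi / √12) := ⟨not_lt.1 h1, h2.trans hlt.le⟩
    rw [Set.indicator_of_mem h4, Pi.one_apply]
    rcases h2.lt_or_eq with h | h
    · rw [Set.indicator_of_notMem fun h' => h.not_ge h'.1]
      ring
    -- At the shared endpoint x = π/4 both indicators are active, but the root vanishes there.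
    · have h5 : x ∈ Set.Icc (Real.pi / 4) (Real.pi / √12) := ⟨h.ge, h4.2⟩
      rw [Set.indicator_of_mem h5, h, div_self (by positivity)]
      simp
  · have h4 : x ∈ Set.Icc 0 (Real.pi / √12) := ⟨not_lt.1 h1, h3⟩
    have h5 : x ∈ Set.Icc (Real.pi / 4) (Real.pi / √12) := ⟨(not_le.1 h2).le, h3⟩
    rw [Set.indicator_of_mem h4, Set.indicator_of_mem h5, Pi.one_apply, e]
  · have h4 : x ∉ Set.Icc 0 (Real.pi / √12) := fun h => h3 h.2
    have h5 : x ∉ Set.Icc (Real.pi / 4) (Real.pi / √12) := fun h => h3 h.2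
    rw [Set.indicator_of_notMem h4, Set.indicator_of_notMem h5]
    simp

theorem densityFun_nonneg (x : ℝ) : 0 ≤ densityFun x := by
  rcases le_or_gt x 0 with h | h
  · unfold densityFun
    have := Real.pi_pos
    split_ifs with h1 h2 h3
    · exact le_rfl
    · positivity
    · exact absurd (h.trans (by positivity)) h2
    · exact le_rfl
  · unfold densityFun
    have hpi := Real.pi_pos
    split_ifs with h1 h2 h3
    · exact le_rfl
    · positivity
    · refine mul_nonneg (by positivity) ?_
      have h4 : √(1 - (Real.pi / (4 * x)) ^ 2) ≤ 1 / 2 := by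
        rw [Real.sqrt_le_left (by norm_num), div_pow]
        have h5 : x ^ 2 ≤ Real.pi ^ 2 / 12 := by
          rw [← pi_div_sqrt_twelve_sq]
          gcongr
        have h6 : 3 / 4 ≤ Real.pi ^ 2 / (4 * x) ^ 2 := by
          rw [le_div_iff₀ (by positivity)]
          nlinarith
        linarith
      linarith
    · exact le_rfl

theorem integral_mul_densityFun {w : ℝ → ℝ} (hw : Continuous w) :
    Integrable (fun x => w x * densityFun x) ∧ ∫ x, w x * densityFun x =
      12 / Real.pi ^ 2 * ((∫ x in (0)..(Real.pi / √12), w x) -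
        2 * ∫ x in (Real.pi / 4)..(Real.pi / √12), w x * √(1 - (Real.pi / 4 / x) ^ 2)) := by
  have hpi := Real.pi_pos
  have hlt := pi_div_four_lt_pi_div_sqrt_twelve
  have e : (fun x => w x * densityFun x) = fun x => 12 / Real.pi ^ 2 *
      ((Set.Icc 0 (Real.pi / √12)).indicator w x -
      2 * (Set.Icc (Real.pi / 4) (Real.pi / √12)).indicator
        (fun x => w x * √(1 - (Real.pi / 4 / x) ^ 2)) x) := by
    ext x
    rw [densityFun_eq_indicator]
    simp only [Set.indicator_apply, Pi.one_apply]
    split_ifs <;> ring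
  have hcont : ContinuousOn (fun x => w x * √(1 - (Real.pi / 4 / x) ^ 2))
      (Set.Icc (Real.pi / 4) (Real.pi / √12)) := by
    refine hw.continuousOn.mul (ContinuousOn.sqrt (continuousOn_const.sub (ContinuousOn.pow
      (continuousOn_const.div continuousOn_id fun x hx => ?_) 2)))
    have : 0 < x := (by positivity : 0 < Real.pi / 4).trans_le hx.1
    exact this.ne'
  have i1 : Integrable ((Set.Icc 0 (Real.pi / √12)).indicator w) :=
    (hw.continuousOn.integrableOn_Icc).integrable_indicator measurableSet_Icc
  have i2 : Integrable ((Set.Icc (Real.pi / 4) (Real.pi / √12)).indicator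
      (fun x => w x * √(1 - (Real.pi / 4 / x) ^ 2))) :=
    (hcont.integrableOn_Icc).integrable_indicator measurableSet_Icc
  rw [e]
  refine ⟨(i1.sub (i2.const_mul 2)).const_mul _, ?_⟩
  rw [integral_const_mul, integral_sub i1 (i2.const_mul 2), integral_const_mul,
    integral_indicator measurableSet_Icc, integral_indicator measurableSet_Icc,
    intervalIntegral.integral_of_le (by positivity), intervalIntegral.integral_of_le hlt.le,
    integral_Icc_eq_integral_Ioc, integral_Icc_eq_integral_Ioc]

variable {a x : ℝ}

theorem sqrt_one_sub_div_sq_pos (ha : 0 < a) (hx : a < x) : 0 < 1 - (a / x) ^ 2 := by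
  have hx0 := ha.trans hx
  have h1 : a / x < 1 := (div_lt_one hx0).2 hx
  have h2 : 0 < a / x := by positivity
  nlinarith

theorem hasDerivAt_sqrt_one_sub_div_sq (ha : 0 < a) (hx : a < x) :
    HasDerivAt (fun x => √(1 - (a / x) ^ 2)) (a ^ 2 / x ^ 3 / √(1 - (a / x) ^ 2)) x := by
  have hx0 := (ha.trans hx).ne'
  have hpos := sqrt_one_sub_div_sq_pos ha hx
  have h1 : HasDerivAt (fun x => 1 - (a / x) ^ 2) (2 * (a ^ 2 / x ^ 3)) x := by
    have := (((hasDerivAt_inv hx0).const_mul a).pow 2).const_sub 1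
    convert! this using 1
    simp
    field_simp
  convert! h1.sqrt hpos.ne' using 1
  have := (Real.sqrt_pos.2 hpos).ne'
  field_simp

theorem continuousOn_sqrt_one_sub_div_sq {b : ℝ} (ha : 0 < a) :
    ContinuousOn (fun x => √(1 - (a / x) ^ 2)) (Set.Icc a b) := by
  refine ContinuousOn.sqrt (continuousOn_const.sub (ContinuousOn.pow
    (continuousOn_const.div continuousOn_id fun x hx => ?_) 2))
  exact (ha.trans_le hx.1).ne'

theorem sqrt_one_sub_div_sq_end (ha : 0 < a) : √(1 - (a / (2 * a / √3)) ^ 2) = 1 / 2 := by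
  have h3 : √3 ^ 2 = (3 : ℝ) := Real.sq_sqrt (by norm_num)
  have hs : (0 : ℝ) < √3 := by positivity
  have : 1 - (a / (2 * a / √3)) ^ 2 = (1 / 2) ^ 2 := by
    field_simp
    rw [h3]
    norm_num
  rw [this, Real.sqrt_sq (by norm_num)]

theorem lt_two_mul_div_sqrt_three (ha : 0 < a) : a < 2 * a / √3 := by
  have hs : (0 : ℝ) < √3 := by positivity
  have : √3 < 2 := by
    rw [Real.sqrt_lt' (by norm_num)]
    norm_num
  rw [lt_div_iff₀ hs]
  nlinarith

theorem sqrt_one_sub_div_self_sq (ha : 0 < a) : √(1 - (a / a) ^ 2) = 0 := by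
  rw [div_self ha.ne']
  simp

theorem integral_sqrt_one_sub_div_sq (ha : 0 < a) :
    ∫ x in a..(2 * a / √3), √(1 - (a / x) ^ 2) = a / √3 - a * (Real.pi / 6) := by
  have hab := lt_two_mul_div_sqrt_three ha
  have hs : (0 : ℝ) < √3 := by positivity
  rw [intervalIntegral.integral_eq_sub_of_hasDerivAt_of_le (a := a) (b := 2 * a / √3)
    -- In terms of √(x² - a²) this is the usual primitive of √(x² - a²)/x; at the upper end the
    -- arccosine is π/6.
    (f := fun x => x * √(1 - (a / x) ^ 2) - a * Real.arccos (a / x)) hab.le]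
  · rw [sqrt_one_sub_div_self_sq ha, sqrt_one_sub_div_sq_end ha, div_self ha.ne', Real.arccos_one]
    have h1 : a / (2 * a / √3) = Real.cos (Real.pi / 6) := by
      rw [Real.cos_pi_div_six]
      field_simp
    rw [h1, Real.arccos_cos (by positivity) (by linarith [Real.pi_pos])]
    ring
  · refine (continuousOn_id.mul (continuousOn_sqrt_one_sub_div_sq ha)).sub
      (continuousOn_const.mul (Real.continuous_arccos.comp_continuousOn
        (continuousOn_const.div continuousOn_id fun x hx => (ha.trans_le hx.1).ne')))
  · intro x hx
    have hx0 := ha.trans hx.1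
    have hpos := sqrt_one_sub_div_sq_pos ha hx.1
    have hsq := (Real.sqrt_pos.2 hpos).ne'
    have h1 := hasDerivAt_sqrt_one_sub_div_sq ha hx.1
    have h2 : HasDerivAt (fun x => a / x) (-(a / x ^ 2)) x := by
      have := (hasDerivAt_inv hx0.ne').const_mul a
      convert! this using 1
      field_simp
    have hlt : a / x < 1 := (div_lt_one hx0).2 hx.1
    have hgt : 0 < a / x := by positivity
    have h3 := (Real.hasDerivAt_arccos (by linarith) hlt.ne).comp x h2
    convert! ((hasDerivAt_id x).mul h1).sub (h3.const_mul a) using 1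
    simp only [id]
    generalize √(1 - (a / x) ^ 2) = s at *
    field_simp
    ring
  · exact ContinuousOn.intervalIntegrable (by
      rw [Set.uIcc_of_le hab.le]
      exact continuousOn_sqrt_one_sub_div_sq ha)

theorem integral_id_mul_sqrt_one_sub_div_sq (ha : 0 < a) :
    ∫ x in a..(2 * a / √3), x * √(1 - (a / x) ^ 2) = a ^ 2 / 3 - a ^ 2 * Real.log 3 / 4 := by
  have hab := lt_two_mul_div_sqrt_three ha
  have hs : (0 : ℝ) < √3 := by positivity
  have h3 : √3 ^ 2 = (3 : ℝ) := Real.sq_sqrt (by norm_num)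
  rw [intervalIntegral.integral_eq_sub_of_hasDerivAt_of_le (a := a) (b := 2 * a / √3)
    (f := fun x => (x ^ 2 * √(1 - (a / x) ^ 2) -
      a ^ 2 * Real.log (x * (1 + √(1 - (a / x) ^ 2)))) / 2) hab.le]
  · simp only [sqrt_one_sub_div_self_sq ha, sqrt_one_sub_div_sq_end ha]
    have h1 : 2 * a / √3 * (1 + 1 / 2) = a * √3 := by
      field_simp
      rw [h3]
      norm_num
    rw [h1, Real.log_mul ha.ne' hs.ne', Real.log_sqrt (by norm_num), add_zero, mul_one, div_pow, h3]
    ring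
  · have hc := continuousOn_sqrt_one_sub_div_sq (b := 2 * a / √3) ha
    refine (((continuousOn_id.pow 2).mul hc).sub (continuousOn_const.mul
      (ContinuousOn.log (continuousOn_id.mul (continuousOn_const.add hc)) fun x hx => ?_))).div_const
      2
    have hx0 := ha.trans_le hx.1
    have : 0 < x * (1 + √(1 - (a / x) ^ 2)) := by positivity
    exact this.ne'
  · intro x hx
    have hx0 := ha.trans hx.1
    have hpos := sqrt_one_sub_div_sq_pos ha hx.1
    have hsq := Real.sqrt_pos.2 hpos
    have h1 := hasDerivAt_sqrt_one_sub_div_sq ha hx.1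
    have h2 := ((hasDerivAt_id x).mul (h1.const_add 1)).log
      (by simp only [Pi.mul_apply, id]; positivity)
    convert! ((((hasDerivAt_id x).pow 2).mul h1).sub (h2.const_mul (a ^ 2))).div_const 2 using 1
    have hs2 : √(1 - (a / x) ^ 2) ^ 2 = 1 - (a / x) ^ 2 := Real.sq_sqrt hpos.le
    -- Eliminating a² in favour of x and the root s turns the derivative identity into a rational
    -- one in x and s.
    have ha2 : a ^ 2 = x ^ 2 * (1 - √(1 - (a / x) ^ 2) ^ 2) := by
      rw [hs2]
      field_simp
      ring
    simp only [id, Pi.mul_apply, Pi.pow_apply]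
    generalize √(1 - (a / x) ^ 2) = s at *
    rw [ha2]
    field_simp
    ring
  · exact ContinuousOn.intervalIntegrable (by
      rw [Set.uIcc_of_le hab.le]
      exact continuousOn_id.mul (continuousOn_sqrt_one_sub_div_sq ha))

theorem integral_sq_mul_sqrt_one_sub_div_sq (ha : 0 < a) :
    ∫ x in a..(2 * a / √3), x ^ 2 * √(1 - (a / x) ^ 2) = a ^ 3 / (9 * √3) := by
  have hab := lt_two_mul_div_sqrt_three ha
  have hs : (0 : ℝ) < √3 := by positivity
  have h3 : √3 ^ 2 = (3 : ℝ) := Real.sq_sqrt (by norm_num)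
  rw [intervalIntegral.integral_eq_sub_of_hasDerivAt_of_le (a := a) (b := 2 * a / √3)
    -- This is (x² - a²)^{3/2}/3.
    (f := fun x => x ^ 3 * √(1 - (a / x) ^ 2) ^ 3 / 3) hab.le]
  · rw [sqrt_one_sub_div_self_sq ha, sqrt_one_sub_div_sq_end ha]
    have h4 : √3 ^ 3 = 3 * √3 := by rw [pow_succ, h3]
    field_simp
    rw [h4]
    ring_nf
    rw [h3]
    norm_num
  · exact ((continuousOn_id.pow 3).mul ((continuousOn_sqrt_one_sub_div_sq ha).pow 3)).div_const 3
  · intro x hx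
    have hx0 := ha.trans hx.1
    have hpos := sqrt_one_sub_div_sq_pos ha hx.1
    have hsq := Real.sqrt_pos.2 hpos
    have h1 := hasDerivAt_sqrt_one_sub_div_sq ha hx.1
    convert! (((hasDerivAt_id x).pow 3).mul (h1.pow 3)).div_const 3 using 1
    have hs2 : √(1 - (a / x) ^ 2) ^ 2 = 1 - (a / x) ^ 2 := Real.sq_sqrt hpos.le
    have ha2 : a ^ 2 = x ^ 2 * (1 - √(1 - (a / x) ^ 2) ^ 2) := by
      rw [hs2]
      field_simp
      ring
    simp only [id, Pi.pow_apply]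
    generalize √(1 - (a / x) ^ 2) = s at *
    rw [ha2]
    field_simp
    norm_num
    ring
  · exact ContinuousOn.intervalIntegrable (by
      rw [Set.uIcc_of_le hab.le]
      exact (continuousOn_id.pow 2).mul (continuousOn_sqrt_one_sub_div_sq ha))

theorem integral_densityFun : Integrable densityFun ∧ ∫ x, densityFun x = 1 := by
  have h := integral_mul_densityFun (w := fun _ => 1) continuous_const
  simp only [one_mul] at h
  refine ⟨h.1, h.2.trans ?_⟩
  have hpi := Real.pi_pos
  have hs : (0 : ℝ) < √3 := by positivity
  rw [pi_div_sqrt_twelve_eq, integral_sqrt_one_sub_div_sq (by positivity),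
    intervalIntegral.integral_const, smul_eq_mul]
  field_simp
  ring

theorem integral_id_mul_densityFun :
    Integrable (fun x => x * densityFun x) ∧ ∫ x, x * densityFun x = 3 / 8 * Real.log 3 := by
  have h := integral_mul_densityFun (w := fun x => x) continuous_id
  refine ⟨h.1, h.2.trans ?_⟩
  have hpi := Real.pi_pos
  have h3 : √3 ^ 2 = (3 : ℝ) := Real.sq_sqrt (by norm_num)
  rw [pi_div_sqrt_twelve_eq, integral_id_mul_sqrt_one_sub_div_sq (by positivity), integral_id,
    div_pow _ (√3), h3]
  field_simp
  ring

theorem integral_sq_mul_densityFun :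
    Integrable (fun x => x ^ 2 * densityFun x) ∧
      ∫ x, x ^ 2 * densityFun x = Real.pi / (8 * √3) := by
  have h := integral_mul_densityFun (w := fun x => x ^ 2) (continuous_pow 2)
  refine ⟨h.1, h.2.trans ?_⟩
  have hpi := Real.pi_pos
  have hs : (0 : ℝ) < √3 := by positivity
  have h3 : √3 ^ 2 = (3 : ℝ) := Real.sq_sqrt (by norm_num)
  have h4 : √3 ^ 3 = 3 * √3 := by rw [pow_succ, h3]
  rw [pi_div_sqrt_twelve_eq, integral_sq_mul_sqrt_one_sub_div_sq (by positivity), integral_pow,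
    div_pow _ (√3)]
  norm_num
  rw [h4]
  field_simp
  ring

theorem lintegral_densityFun : ∫⁻ x, ENNReal.ofReal (densityFun x) = 1 := by
  rw [← ofReal_integral_eq_lintegral_ofReal integral_densityFun.1
    (Eventually.of_forall densityFun_nonneg), integral_densityFun.2, ENNReal.ofReal_one]

end Moments

/-! ### The maximal density. -/

section Extremal

theorem latticeDensity_mem_Icc (q : SpecialLinearGroup (Fin 2) ℝ ⧸ SL2Z) :
    latticeDensity q ∈ Set.Icc 0 (Real.pi / √12) := by
  induction q using QuotientGroup.induction_on with
  | H g =>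
    obtain ⟨γ, hγ⟩ := exists_isReducedFrame_mul g
    rw [← mk_mul_map g γ, hγ.latticeDensity_eq]
    have := firstNormSq_pos (g * SpecialLinearGroup.map (Int.castRingHom ℝ) γ)
    exact ⟨by positivity, hγ.pi_div_four_mul_firstNormSq_le⟩

theorem isGreatest_range_latticeDensity :
    IsGreatest (Set.range latticeDensity) (Real.pi / √12) := by
  constructor
  · obtain ⟨g, hg, h⟩ := exists_isReducedFrame_hexagonal
    exact ⟨g, by rw [hg.latticeDensity_eq, h]⟩
  · rintro _ ⟨q, rfl⟩
    exact (latticeDensity_mem_Icc q).2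

theorem isGreatest_packingDensity_lattices :
    IsGreatest {δ : ℝ | ∃ (L : Submodule ℤ (EuclideanSpace ℝ (Fin 2))) (_ : DiscreteTopology L),
      IsZLattice ℝ L ∧ δ = packingDensity (L : Set (EuclideanSpace ℝ (Fin 2)))}
      (Real.pi / √12) := by
  constructor
  · obtain ⟨g, hg, h⟩ := exists_isReducedFrame_hexagonal
    have := discreteTopology_columnLattice g
    refine ⟨columnLattice g, this, isZLattice_columnLattice g, ?_⟩
    rw [← latticeDensity_mk, hg.latticeDensity_eq, h]
  · rintro _ ⟨L, _, _, rfl⟩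
    -- An arbitrary lattice has a ℤ-basis of two vectors, so it is a dilate of a unimodular lattice
    -- with a reduced basis.
    have := ZLattice.module_free ℝ L
    have := ZLattice.module_finite ℝ L
    have hrank : Module.finrank ℤ L = 2 := by rw [ZLattice.rank ℝ L]; simp
    obtain ⟨s, g, hs, hg, hL, hcov⟩ := exists_isReducedFrame_of_isZLattice L
      (Module.finBasisOfFinrankEq ℤ L hrank)
    rw [packingDensity_of_reduced L hs hg hL hcov]
    exact hg.pi_div_four_mul_firstNormSq_le

end Extremal

/-! ### Assembly of the law, the moments and the maximum. -/

theorem integral_withDensity_densityFun (f : ℝ → ℝ) :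
    ∫ x, f x ∂(volume.withDensity fun x => ENNReal.ofReal (densityFun x)) =
      ∫ x, f x * densityFun x := by
  rw [integral_withDensity_eq_integral_toReal_smul measurable_densityFun.ennreal_ofReal
    (Eventually.of_forall fun _ => ENNReal.ofReal_lt_top)]
  refine integral_congr_ae (Eventually.of_forall fun x => ?_)
  simp only [ENNReal.toReal_ofReal (densityFun_nonneg x), smul_eq_mul, mul_comm]

theorem theorem3
    [MeasurableSpace (SpecialLinearGroup (Fin 2) ℝ ⧸ SL2Z)]
    [BorelSpace (SpecialLinearGroup (Fin 2) ℝ ⧸ SL2Z)]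
    (μ : Measure (SpecialLinearGroup (Fin 2) ℝ ⧸ SL2Z)) [IsProbabilityMeasure μ]
    [SMulInvariantMeasure (SpecialLinearGroup (Fin 2) ℝ)
      (SpecialLinearGroup (Fin 2) ℝ ⧸ SL2Z) μ] :
    Measurable latticeDensity ∧
    μ.map latticeDensity = volume.withDensity (fun x => ENNReal.ofReal (densityFun x)) ∧
    (Integrable latticeDensity μ ∧ ∫ q, latticeDensity q ∂μ = 3 / 8 * Real.log 3) ∧
    (MemLp latticeDensity 2 μ ∧
      ProbabilityTheory.variance latticeDensity μ =
        Real.pi / (8 * √3) - 9 / 64 * (Real.log 3) ^ 2) ∧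
    IsGreatest (Set.range latticeDensity) (Real.pi / √12) ∧
    IsGreatest {δ : ℝ | ∃ (L : Submodule ℤ (EuclideanSpace ℝ (Fin 2))) (_ : DiscreteTopology L),
      IsZLattice ℝ L ∧ δ = packingDensity (L : Set (EuclideanSpace ℝ (Fin 2)))}
      (Real.pi / √12) := by
  borelize (SpecialLinearGroup (Fin 2) ℝ)
  have hmeas : Measurable latticeDensity := measurable_latticeDensity_of_borelSpace
  have hmap : μ.map latticeDensity =
      volume.withDensity (fun x => ENNReal.ofReal (densityFun x)) := by
    obtain ⟨C, hC⟩ := exists_map_latticeDensity_eq μ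
    -- Comparing total masses gives C = 1.
    have h1 := congrArg (fun ν : Measure ℝ => ν Set.univ) hC
    simp only [Measure.map_apply hmeas MeasurableSet.univ, Set.preimage_univ, measure_univ,
      Measure.smul_apply, withDensity_apply _ MeasurableSet.univ, Measure.restrict_univ,
      lintegral_densityFun, smul_eq_mul, mul_one] at h1
    rw [hC, ← h1, one_smul]
  have hLp : MemLp latticeDensity 2 μ := by
    refine MemLp.of_bound hmeas.aestronglyMeasurable (Real.pi / √12)
      (Eventually.of_forall fun q => ?_)
    rw [Real.norm_of_nonneg (latticeDensity_mem_Icc q).1]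
    exact (latticeDensity_mem_Icc q).2
  have hmean : ∫ q, latticeDensity q ∂μ = 3 / 8 * Real.log 3 := by
    have h := integral_map (μ := μ) hmeas.aemeasurable (f := fun x : ℝ => x)
      measurable_id.aestronglyMeasurable
    rw [← h, hmap, integral_withDensity_densityFun, integral_id_mul_densityFun.2]
  have hsecond : ∫ q, latticeDensity q ^ 2 ∂μ = Real.pi / (8 * √3) := by
    have h := integral_map (μ := μ) hmeas.aemeasurable (f := fun x : ℝ => x ^ 2)
      (measurable_id.pow_const 2).aestronglyMeasurable
    rw [← h, hmap, integral_withDensity_densityFun, integral_sq_mul_densityFun.2]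
  refine ⟨hmeas, hmap, ⟨hLp.integrable (by norm_num), hmean⟩, ⟨hLp, ?_⟩,
    isGreatest_range_latticeDensity, isGreatest_packingDensity_lattices⟩
  rw [ProbabilityTheory.variance_eq_sub hLp, hmean]
  simp only [Pi.pow_apply, hsecond]
  ring
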